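/- Let $n\in\mathbb N$ and let $A\in\mathbb R^{n\times n}$ have matrix 2-norm $\|A\|_2=\hat\lambda<1$. Let $\epsilon_0,\epsilon_1,\dots$ be i.i.d. $\mathcal N(0,I_n)$ random vectors, let $x\in\mathbb R^n$ be deterministic, and let $y_0=x$, $y_{t+1}=Ay_t+\epsilon_t$ for $t\ge 0$. Write $P(x,\cdot)=\mathcal N(Ax,I_n)$ for the transition kernel, $\mathbb P^N$ for the law of $(y_1,\dots,y_N)$ on $(\mathbb R^n)^N$, $d(u,v)=\|u-v\|$ for the Euclidean distance, and $d_{(N)}(u,v)=\sum_{i=1}^N\|u_i-v_i\|$. For a distance $\rho$, let $\mathcal W_\rho(\mu,\nu)$ be the infimum of $\int \rho\,d\pi$ over all couplings $\pi$ of $\mu$ and $\nu$. For $C>0$, a probability measure $\mu$ satisfies $T_1^{\rho}(C)$ if $\mathcal W_\rho(\mu,\nu)\le\sqrt{2C\,\mathrm{Ent}(\nu\|\mu)}$ for every probability measure $\nu$, where $\mathrm{Ent}(\nu\|\mu)=\int\log\frac{d\nu}{d\mu}\,d\nu$ if $\nu\ll\mu$ and $+\infty$ otherwise. Then: 1. For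 every $N\ge 1$, $\mathbb P^N$ satisfies $T_1^{d_{(N)}}\!\left(\frac{N}{(1-\hat\lambda)^2}\right)$. 2. The kernel $P$ has exactly one invariant probability measure $\nu_\pi$; moreover $\langle\|y\|\rangle_{\nu_\pi}:=\int\|v\|\,\nu_\pi(dv)<\infty$ and $\mathcal W_d(P(x,\cdot),\nu_\pi)<\infty$. For every $N\ge1$ the empirical average $\frac1N\sum_{i=1}^N\|y_i\|$ is integrable, and for every $\varepsilon>0$ $$\mathbb P^N\!\left[\Big|\tfrac1N\sum_{i=1}^N\|y_i\|-\langle\|y\|\rangle_{\nu_\pi}\Big|>\frac{\mathcal W_d(P(x,\cdot),\nu_\pi)}{N(1-\hat\lambda)}+\varepsilon\right]\le\mathbb P^N\!\left[\Big|\tfrac1N\sum_{i=1}^N\|y_i\|-\mathbb E\Big(\tfrac1N\sum_{i=1}^N\|y_i\|\Big)\Big|>\varepsilon\right]\le 2\exp\!\left(-\frac{N\varepsilon^2(1-\hat\lambda)^2}{2}\right).$$ -/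

import Mathlib

open MeasureTheory ProbabilityTheory InformationTheory
open scoped ENNReal

noncomputable section

/-- The Wasserstein distance of order one between `μ` and `ν` for the distance function `d`:
the infimum of `∫ d(x, y) dπ(x, y)` over all couplings `π` of `μ` and `ν`. -/
def wassersteinDist {X : Type*} [MeasurableSpace X] (d : X → X → ℝ) (μ ν : Measure X) : ℝ≥0∞ :=
  ⨅ (π : Measure (X × X)) (_ : π.fst = μ ∧ π.snd = ν), ∫⁻ z, ENNReal.ofReal (d z.1 z.2) ∂π

/-- The transport-entropy inequality `T₁^d(C)`, with `C > 0`: for every probability measure `ν`,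
`W_d(μ, ν) ≤ √(2 C Ent(ν‖μ))`, where `Ent(ν‖μ)` is the relative entropy (`∞` unless `ν ≪ μ`). -/
def TransportEntropyOne {X : Type*} [MeasurableSpace X] (d : X → X → ℝ) (C : ℝ)
    (μ : Measure X) : Prop :=
  0 < C ∧ ∀ ν : Measure X, IsProbabilityMeasure ν →
    wassersteinDist d μ ν ≤ (2 * ENNReal.ofReal C * klDiv ν μ) ^ (1 / 2 : ℝ)

/-- The `ℓ¹` extension of a distance function to `N`-tuples: `∑ i, d (x i) (y i)`. -/
def sumDist {X : Type*} (d : X → X → ℝ) (N : ℕ) (x y : Fin N → X) : ℝ :=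
  ∑ i, d (x i) (y i)

/-- The state space `ℝⁿ` with its Euclidean norm. -/
abbrev StateSpace (n : ℕ) : Type := EuclideanSpace ℝ (Fin n)

/-- The Euclidean linear map `x ↦ A x`; its operator norm is the matrix 2-norm of `A`. -/
abbrev matrixCLM {n : ℕ} (A : Matrix (Fin n) (Fin n) ℝ) : StateSpace n →L[ℝ] StateSpace n :=
  Matrix.toEuclideanCLM (n := Fin n) (𝕜 := ℝ) A

/-- The transition kernel of `y ↦ A y + ε` with `ε ∼ N(0, I_n)`:
`P(x, ·)` is the law of `A x + ε`. -/
def ldsKernel {n : ℕ} (A : Matrix (Fin n) (Fin n) ℝ) : Kernel (StateSpace n) (StateSpace n) where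
  toFun x := (stdGaussian (StateSpace n)).map (fun e => matrixCLM A x + e)
  measurable' := by
    refine Measure.measurable_of_measurable_coe _ fun s hs => ?_
    have h : Measurable fun p : StateSpace n × StateSpace n => matrixCLM A p.1 + p.2 := by
      fun_prop
    have h2 := measurable_measure_prodMk_left (ν := stdGaussian (StateSpace n)) (h hs)
    convert h2 using 2 with x
    rw [Measure.map_apply (by fun_prop) hs]
    rfl

/-- The joint law of `(y 1, …, y N)` under `Pr`. -/
def pathLaw {Ω X : Type*} [MeasurableSpace Ω] [MeasurableSpace X] (Pr : Measure Ω)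
    (y : ℕ → Ω → X) (N : ℕ) : Measure (Fin N → X) :=
  Pr.map (fun ω i => y (i + 1) ω)

/-- The empirical average `(1 / N) ∑ i, ‖z i‖` along a path `z`. -/
def avgNorm {n N : ℕ} (z : Fin N → StateSpace n) : ℝ :=
  (1 / (N : ℝ)) * ∑ i, ‖z i‖

end

/-!
The path `(y 1, …, y N)` is the image of `N` independent standard Gaussian vectors under an affine
map. Because `‖y (t + 1) - y' (t + 1)‖ ≤ ‖A‖ ‖y t - y' t‖ + ‖e t - e' t‖`, summation over time shows
that this map is `1 / (1 - ‖A‖)`-Lipschitz for the `ℓ¹` distances, hence `√N / (1 - ‖A‖)`-Lipschitz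
from the Euclidean distance on the noise to the `ℓ¹` distance on paths. So everything about paths
follows from dimension-free facts about Gaussian measures.

*Transport inequality.* By the Bobkov–Götze criterion
(`transportEntropyOne_of_hasSubgaussianMGF`), `T₁(C)` holds as soon as every `1`-Lipschitz function
is sub-Gaussian with constant `C`: the Gibbs variational inequality bounds `∫ g dν - ∫ g dμ` by
`√(2 C Ent(ν‖μ))`, and Kantorovich duality turns this into a bound on the transport cost. Only the
finite case of duality is proved (`exists_transportPlan_of_duality`, by convex separation); the
general case is reached by quantizing the space with simple functions and gluing the discrete plan
into a coupling (`wassersteinDist_le_of_quantization`).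

*Sharp sub-Gaussian bound.* The Prékopa–Leindler inequality with weights `1 - s, s` on the line,
taken relative to the Gaussian density, says that `u(x)^(1-s) v(y)^s ≤ exp(s (1-s) (x-y)² / 2)`
implies `(∫ u dγ)^(1-s) (∫ v dγ)^s ≤ 1`. This form tensorizes over products. For an `L`-Lipschitz
`G` one takes `v = exp G` and `u = exp (-(s / (1 - s)) G)`; Jensen's inequality for `u` and the
limit `s → 0` give `∫ exp G ≤ exp (∫ G + L² / 2)` (`hasSubgaussianMGF_of_prekopaLeindlerIneq`). The
concentration of the empirical mean is the Chernoff bound for the same estimate.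

*Invariant measure.* The characteristic function of an invariant measure satisfies
`φ(t) = φ(Aᵀ t) exp(-‖t‖² / 2)`, which determines it since `(Aᵀ)ᵏ → 0`; the centered Gaussian
measure with covariance `∑ Aᵏ (Aᵏ)ᵀ` is a solution. The bias of the empirical mean is controlled
because the `k`-step transition operator contracts Lipschitz constants by `‖A‖ᵏ`
(`abs_integral_norm_sub_le`), and these factors sum to at most `1 / (1 - ‖A‖)`.
-/

/-! ### The Prékopa–Leindler inequality on the line -/

open scoped Pointwise in
/-- The Brunn–Minkowski inequality on the line. For compact sets, the translates `A + min B` and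
`max A + B` overlap in at most one point. -/
lemma volume_add_volume_le_of_add_subset {A B C : Set ℝ} (hA : MeasurableSet A)
    (hB : MeasurableSet B) (hA0 : A.Nonempty) (hB0 : B.Nonempty) (hC : A + B ⊆ C) :
    volume A + volume B ≤ volume C := by
  have key : ∀ K ⊆ A, IsCompact K → ∀ L ⊆ B, IsCompact L → volume K + volume L ≤ volume C := by
    intro K hKA hK L hLB hL
    rcases K.eq_empty_or_nonempty with rfl | hK0
    · obtain ⟨a, ha⟩ := hA0
      have h1 : a +ᵥ L ⊆ C := by
        rintro _ ⟨l, hl, rfl⟩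
        exact hC (Set.add_mem_add ha (hLB hl))
      simpa using measure_mono (μ := volume) h1
    rcases L.eq_empty_or_nonempty with rfl | hL0
    · obtain ⟨b, hb⟩ := hB0
      have h1 : b +ᵥ K ⊆ C := by
        rintro _ ⟨l, hl, rfl⟩
        simpa [add_comm] using hC (Set.add_mem_add (hKA hl) hb)
      simpa using measure_mono (μ := volume) h1
    obtain ⟨a, haK, ha⟩ := hK.exists_isGreatest hK0
    obtain ⟨b, hbL, hb⟩ := hL.exists_isLeast hL0
    have hd : volume ((b +ᵥ K) ∩ (a +ᵥ L)) = 0 := by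
      refine measure_mono_null (t := {a + b}) ?_ (by simp)
      rintro _ ⟨⟨k, hk, rfl⟩, ⟨l, hl, h⟩⟩
      have h1 := ha hk
      have h2 := hb hl
      simp only [vadd_eq_add] at h ⊢
      simp only [Set.mem_singleton_iff]
      linarith
    calc volume K + volume L = volume (b +ᵥ K) + volume (a +ᵥ L) := by simp
      _ = volume ((b +ᵥ K) ∪ (a +ᵥ L)) := by
          rw [← measure_union_add_inter _ (hL.vadd a).measurableSet, hd, add_zero]
      _ ≤ volume C := by
          refine measure_mono (Set.union_subset ?_ ?_)
          · rintro _ ⟨l, hl, rfl⟩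
            simpa [add_comm] using hC (Set.add_mem_add (hKA hl) (hLB hbL))
          · rintro _ ⟨l, hl, rfl⟩
            exact hC (Set.add_mem_add (hKA haK) (hLB hl))
  rw [hA.measure_eq_iSup_isCompact, hB.measure_eq_iSup_isCompact]
  simp only [iSup_and']
  exact ENNReal.biSup_add_biSup_le' ⟨∅, by simp⟩ ⟨∅, by simp⟩
    fun K hK L hL => key K hK.1 hK.2 L hL.1 hL.2

open scoped Pointwise in
/-- The Prékopa–Leindler inequality on the line for functions with supremum `1`, where it holds
in additive form: it is the Brunn–Minkowski inequality integrated over the superlevel sets. -/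
lemma integral_add_le_of_prekopaLeindler {s : ℝ} (hs0 : 0 < s) (hs1 : s < 1) {u v h : ℝ → ℝ}
    (hu : Measurable u) (hv : Measurable v) (hh : Measurable h)
    (hu0 : ∀ x, 0 ≤ u x) (hv0 : ∀ x, 0 ≤ v x) (hh0 : ∀ x, 0 ≤ h x)
    (hu1 : ∀ x, u x ≤ 1) (hv1 : ∀ x, v x ≤ 1)
    (hus : ∀ t < 1, ∃ x, t < u x) (hvs : ∀ t < 1, ∃ x, t < v x)
    (H : ∀ x y, u x ^ (1 - s) * v y ^ s ≤ h ((1 - s) * x + s * y)) :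
    ENNReal.ofReal (1 - s) * (∫⁻ x, ENNReal.ofReal (u x))
        + ENNReal.ofReal s * (∫⁻ x, ENNReal.ofReal (v x))
      ≤ ∫⁻ x, ENNReal.ofReal (h x) := by
  have hlc : ∀ f : ℝ → ℝ, Measurable f → (∀ x, 0 ≤ f x) →
      ∫⁻ x, ENNReal.ofReal (f x) = ∫⁻ t in Set.Ioi 0, volume {x | t < f x} := fun f hf hf0 =>
    lintegral_eq_lintegral_meas_lt volume (Filter.Eventually.of_forall hf0) hf.aemeasurable
  have hm : ∀ f : ℝ → ℝ, Measurable fun t => volume {x | t < f x} := fun f =>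
    Antitone.measurable fun a b hab => measure_mono fun x hx => lt_of_le_of_lt hab hx
  rw [hlc u hu hu0, hlc v hv hv0, hlc h hh hh0, ← lintegral_const_mul _ (hm u),
    ← lintegral_const_mul _ (hm v), ← lintegral_add_left ((hm u).const_mul _)]
  refine setLIntegral_mono (hm h) fun t (ht : 0 < t) => ?_
  rcases le_or_gt 1 t with h1t | ht1
  · have e1 : {x | t < u x} = ∅ := by
      ext x; simpa using (hu1 x).trans h1t
    have e2 : {x | t < v x} = ∅ := by
      ext x; simpa using (hv1 x).trans h1t
    simp [e1, e2]
  have hs1' : 0 < 1 - s := by linarith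
  have e1 : ENNReal.ofReal (1 - s) * volume {x | t < u x} = volume ((1 - s) • {x | t < u x}) := by
    rw [Measure.addHaar_smul]; simp [abs_of_pos hs1']
  have e2 : ENNReal.ofReal s * volume {x | t < v x} = volume (s • {x | t < v x}) := by
    rw [Measure.addHaar_smul]; simp [abs_of_pos hs0]
  rw [e1, e2]
  refine volume_add_volume_le_of_add_subset
    ((measurableSet_lt measurable_const hu).const_smul₀ _)
    ((measurableSet_lt measurable_const hv).const_smul₀ _)
    (Set.Nonempty.smul_set (hus t ht1)) (Set.Nonempty.smul_set (hvs t ht1)) ?_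
  rintro _ ⟨_, ⟨x, hx, rfl⟩, _, ⟨y, hy, rfl⟩, rfl⟩
  refine lt_of_lt_of_le ?_ (H x y)
  calc t = t ^ (1 - s) * t ^ s := by rw [← Real.rpow_add ht]; simp
    _ < u x ^ (1 - s) * v y ^ s :=
      mul_lt_mul'' (Real.rpow_lt_rpow ht.le hx hs1') (Real.rpow_lt_rpow ht.le hy hs0)
        (by positivity) (by positivity)

lemma geom_mean_le_arith_mean_ennreal {s : ℝ} (hs0 : 0 < s) (hs1 : s < 1) (a b : ℝ≥0∞) :
    a ^ (1 - s) * b ^ s ≤ ENNReal.ofReal (1 - s) * a + ENNReal.ofReal s * b := by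
  have hs1' : 0 < 1 - s := by linarith
  have h := ENNReal.young_inequality (a ^ (1 - s)) (b ^ s) (p := (1 - s)⁻¹) (q := s⁻¹)
    (Real.holderConjugate_iff.2 ⟨(one_lt_inv₀ hs1').2 (by linarith), by simp⟩)
  rw [← ENNReal.rpow_mul, ← ENNReal.rpow_mul, mul_inv_cancel₀ hs1'.ne', mul_inv_cancel₀ hs0.ne',
    ENNReal.ofReal_inv_of_pos hs1', ENNReal.ofReal_inv_of_pos hs0] at h
  simpa [div_eq_mul_inv, mul_comm] using h

/-- The Prékopa–Leindler inequality on the line. -/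
theorem prekopaLeindler_real {s : ℝ} (hs0 : 0 < s) (hs1 : s < 1) {u v h : ℝ → ℝ≥0∞}
    (hu : Measurable u) (hv : Measurable v) (hh : Measurable h)
    (H : ∀ x y, u x ^ (1 - s) * v y ^ s ≤ h ((1 - s) * x + s * y)) :
    (∫⁻ x, u x) ^ (1 - s) * (∫⁻ x, v x) ^ s ≤ ∫⁻ x, h x := by
  have hs1' : 0 < 1 - s := by linarith
  -- reduction to bounded functions
  wlog hb : (∃ n : ℕ, ∀ x, u x ≤ n) ∧ (∃ n : ℕ, ∀ x, v x ≤ n) generalizing u v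
  · have hmono : ∀ f : ℝ → ℝ≥0∞, Measurable f →
        ∫⁻ x, f x = ⨆ n : ℕ, ∫⁻ x, min (f x) n := fun f hf => by
      rw [← lintegral_iSup (fun n => hf.min measurable_const)
        (fun m n hmn x => min_le_min le_rfl (by exact_mod_cast hmn))]
      refine lintegral_congr fun x => ?_
      have := inf_iSup_eq (f x) (fun n : ℕ => (n : ℝ≥0∞))
      rw [ENNReal.iSup_natCast, inf_top_eq] at this
      exact this
    have hpow : ∀ (a : ℝ), 0 < a → ∀ F : ℕ → ℝ≥0∞, (⨆ n, F n) ^ a = ⨆ n, F n ^ a :=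
      fun a ha F => (ENNReal.orderIsoRpow a ha).map_iSup F
    rw [hmono u hu, hmono v hv, hpow _ hs1', hpow _ hs0]
    simp only [ENNReal.iSup_mul, ENNReal.mul_iSup]
    refine iSup_le fun m => iSup_le fun k => this (hu.min measurable_const)
      (hv.min measurable_const) (fun x y => (mul_le_mul' ?_ ?_).trans (H x y))
      ⟨⟨_, fun x => min_le_right _ _⟩, ⟨_, fun x => min_le_right _ _⟩⟩
    · exact ENNReal.rpow_le_rpow (min_le_left _ _) hs1'.le
    · exact ENNReal.rpow_le_rpow (min_le_left _ _) hs0.le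
  obtain ⟨⟨m, hm⟩, ⟨k, hk⟩⟩ := hb
  -- rescaling to supremum one
  set a := ⨆ x, u x with ha
  set b := ⨆ x, v x with hb
  have hua : ∀ x, u x ≤ a := le_iSup u
  have hvb : ∀ x, v x ≤ b := le_iSup v
  have ha_top : a ≠ ∞ := ne_top_of_le_ne_top (ENNReal.natCast_ne_top m) (iSup_le hm)
  have hb_top : b ≠ ∞ := ne_top_of_le_ne_top (ENNReal.natCast_ne_top k) (iSup_le hk)
  rcases eq_or_ne a 0 with ha0 | ha0
  · have : ∀ x, u x = 0 := fun x => by simpa [ha0] using hua x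
    simp [this, hs1']
  rcases eq_or_ne b 0 with hb0 | hb0
  · have : ∀ x, v x = 0 := fun x => by simpa [hb0] using hvb x
    simp [this, hs0]
  set c := a ^ (1 - s) * b ^ s with hc
  have hc0 : c ≠ 0 := by
    simp [hc, ENNReal.rpow_eq_zero_iff, ha0, hb0, ha_top, hb_top]
  have hc_top : c ≠ ∞ :=
    ENNReal.mul_ne_top (ENNReal.rpow_ne_top_of_nonneg hs1'.le ha_top)
      (ENNReal.rpow_ne_top_of_nonneg hs0.le hb_top)
  have hu1 : ∀ x, u x / a ≤ 1 := fun x => ENNReal.div_le_of_le_mul (by simpa using hua x)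
  have hv1 : ∀ x, v x / b ≤ 1 := fun x => ENNReal.div_le_of_le_mul (by simpa using hvb x)
  have hsup : ∀ (f : ℝ → ℝ≥0∞), (⨆ x, f x) ≠ 0 → (⨆ x, f x) ≠ ∞ → (∀ x, f x / (⨆ x, f x) ≤ 1) →
      ∀ t < (1 : ℝ), ∃ x, t < (f x / (⨆ x, f x)).toReal := by
    intro f h0 h1 hf1 t ht
    rcases lt_or_ge t 0 with ht0 | ht0
    · exact ⟨0, ht0.trans_le ENNReal.toReal_nonneg⟩
    have : ENNReal.ofReal t * (⨆ x, f x) < ⨆ x, f x := by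
      conv_rhs => rw [← one_mul (⨆ x, f x)]
      exact (ENNReal.mul_lt_mul_iff_left h0 h1).2 (by simpa using ht)
    obtain ⟨x, hx⟩ := lt_iSup_iff.1 this
    refine ⟨x, ?_⟩
    rw [← ENNReal.ofReal_lt_iff_lt_toReal ht0 (ne_top_of_le_ne_top ENNReal.one_ne_top (hf1 x))]
    exact (ENNReal.lt_div_iff_mul_lt (Or.inl h0) (Or.inl h1)).2 hx
  -- `h` is cut off at `1` so that it may be read as a real-valued function
  have main := integral_add_le_of_prekopaLeindler hs0 hs1
    (u := fun x => (u x / a).toReal) (v := fun x => (v x / b).toReal)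
    (h := fun x => (min (h x / c) 1).toReal)
    (by fun_prop) (by fun_prop) (by fun_prop) (fun _ => ENNReal.toReal_nonneg)
    (fun _ => ENNReal.toReal_nonneg) (fun _ => ENNReal.toReal_nonneg)
    (fun x => ENNReal.toReal_le_of_le_ofReal zero_le_one (by simpa using hu1 x))
    (fun x => ENNReal.toReal_le_of_le_ofReal zero_le_one (by simpa using hv1 x))
    (hsup u ha0 ha_top hu1) (hsup v hb0 hb_top hv1) (fun x y => by
      rw [ENNReal.toReal_rpow, ENNReal.toReal_rpow, ← ENNReal.toReal_mul]
      refine ENNReal.toReal_mono (by simp) (le_min ?_ ?_)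
      · rw [ENNReal.div_rpow_of_nonneg _ _ hs1'.le, ENNReal.div_rpow_of_nonneg _ _ hs0.le]
        refine le_trans (le_of_eq ?_) (ENNReal.div_le_div_right (H x y) c)
        rw [div_eq_mul_inv, div_eq_mul_inv, div_eq_mul_inv, hc, ENNReal.mul_inv]
        · ring
        · simp [ENNReal.rpow_eq_zero_iff, ha0, hb0, ha_top, hb_top]
        · simp [ENNReal.rpow_eq_zero_iff, ha0, hb0, ha_top, hb_top]
      · exact mul_le_one' (ENNReal.rpow_le_one (hu1 x) hs1'.le)
          (ENNReal.rpow_le_one (hv1 y) hs0.le))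
  have htu : ∀ x, u x / a ≠ ∞ := fun x => ne_top_of_le_ne_top ENNReal.one_ne_top (hu1 x)
  have htv : ∀ x, v x / b ≠ ∞ := fun x => ne_top_of_le_ne_top ENNReal.one_ne_top (hv1 x)
  have hth : ∀ x, min (h x / c) 1 ≠ ∞ := fun x => by simp
  simp only [ENNReal.ofReal_toReal (htu _), ENNReal.ofReal_toReal (htv _),
    ENNReal.ofReal_toReal (hth _)] at main
  have main2 : (∫⁻ x, u x / a) ^ (1 - s) * (∫⁻ x, v x / b) ^ s ≤ ∫⁻ x, h x / c := by
    exact (geom_mean_le_arith_mean_ennreal hs0 hs1 _ _).trans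
      (main.trans (lintegral_mono fun x => min_le_left _ _))
  simp only [div_eq_mul_inv] at main2
  rw [lintegral_mul_const _ hu, lintegral_mul_const _ hv, lintegral_mul_const _ hh,
    ENNReal.mul_rpow_of_nonneg _ _ hs1'.le, ENNReal.mul_rpow_of_nonneg _ _ hs0.le] at main2
  have hca : c * ((a⁻¹) ^ (1 - s) * (b⁻¹) ^ s) = 1 := by
    rw [ENNReal.inv_rpow, ENNReal.inv_rpow, ← ENNReal.mul_inv, ENNReal.mul_inv_cancel hc0 hc_top]
    · simp [ENNReal.rpow_eq_zero_iff, ha0, hb0, ha_top, hb_top]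
    · simp [ENNReal.rpow_eq_zero_iff, ha0, hb0, ha_top, hb_top]
  calc (∫⁻ x, u x) ^ (1 - s) * (∫⁻ x, v x) ^ s
      = c * ((∫⁻ x, u x) ^ (1 - s) * a⁻¹ ^ (1 - s) * ((∫⁻ x, v x) ^ s * b⁻¹ ^ s)) := by
        rw [← one_mul (_ * _), ← hca]; ring
    _ ≤ c * ((∫⁻ x, h x) * c⁻¹) := by gcongr
    _ = ∫⁻ x, h x := by
        rw [mul_comm, mul_assoc, ENNReal.inv_mul_cancel hc0 hc_top, mul_one]

/-! ### Prékopa–Leindler relative to a measure -/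

/-- The functional form of the Prékopa–Leindler inequality relative to a measure `μ` and a cost
`c`, with the weights `1 - s` and `s`. The additive constant `r` is redundant, by scaling, but
makes the inequality directly iterable over the factors of a product. -/
def PrekopaLeindlerIneq {X : Type*} [MeasurableSpace X] (s : ℝ) (c : X → X → ℝ)
    (μ : Measure X) : Prop :=
  ∀ (u v : X → ℝ≥0∞) (r : ℝ), Measurable u → Measurable v →
    (∀ x y, u x ^ (1 - s) * v y ^ s ≤ ENNReal.ofReal (Real.exp (s * (1 - s) / 2 * c x y + r))) →
    (∫⁻ x, u x ∂μ) ^ (1 - s) * (∫⁻ x, v x ∂μ) ^ s ≤ ENNReal.ofReal (Real.exp r)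

namespace PrekopaLeindlerIneq

variable {X Y : Type*} [MeasurableSpace X] [MeasurableSpace Y] {s : ℝ}
  {c : X → X → ℝ} {c' : Y → Y → ℝ} {μ : Measure X} {ν : Measure Y}

lemma map (hμ : PrekopaLeindlerIneq s c μ) (hs0 : 0 < s) (hs1 : s < 1) {T : X → Y}
    (hT : Measurable T) (hc : ∀ x y, c' (T x) (T y) ≤ c x y) :
    PrekopaLeindlerIneq s c' (μ.map T) := by
  intro u v r hu hv h
  rw [lintegral_map hu hT, lintegral_map hv hT]
  refine hμ _ _ r (hu.comp hT) (hv.comp hT) fun x y => (h (T x) (T y)).trans ?_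
  have : 0 ≤ s * (1 - s) / 2 := by
    have : 0 < 1 - s := by linarith
    positivity
  gcongr
  exact hc x y

lemma prod [SFinite μ] [SFinite ν] (hμ : PrekopaLeindlerIneq s c μ)
    (hν : PrekopaLeindlerIneq s c' ν) :
    PrekopaLeindlerIneq s (fun p q : X × Y => c p.1 q.1 + c' p.2 q.2) (μ.prod ν) := by
  intro u v r hu hv h
  rw [lintegral_prod _ hu.aemeasurable, lintegral_prod _ hv.aemeasurable]
  refine hμ _ _ r hu.lintegral_prod_right' hv.lintegral_prod_right' fun x x' => ?_
  refine hν _ _ _ (hu.comp measurable_prodMk_left) (hv.comp measurable_prodMk_left)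
    fun y y' => (h (x, y) (x', y')).trans_eq ?_
  simp only
  congr 2
  ring

lemma pi [SigmaFinite μ] (hs0 : 0 < s) (hs1 : s < 1) (hμ : PrekopaLeindlerIneq s c μ) (N : ℕ) :
    PrekopaLeindlerIneq s (fun x y : Fin N → X => ∑ i, c (x i) (y i))
      (Measure.pi fun _ => μ) := by
  induction N with
  | zero =>
    intro u v r hu hv h
    have h0 := h default default
    rw [Measure.pi_of_empty _ default, lintegral_dirac, lintegral_dirac]
    simpa using h0
  | succ N ih =>
    have e := (measurePreserving_piFinSuccAbove (fun _ : Fin (N + 1) => μ) 0).symm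
    rw [← e.map_eq]
    refine (hμ.prod ih).map hs0 hs1 (MeasurableEquiv.measurable _) fun x y => le_of_eq ?_
    simp [Fin.sum_univ_succ]

end PrekopaLeindlerIneq

/-- For the Gaussian density `φ`, `φ(x)^(1-s) φ(y)^s = exp(-s(1-s)(x-y)²/2) φ((1-s)x+sy)`. -/
lemma prekopaLeindlerIneq_gaussianReal {s : ℝ} (hs0 : 0 < s) (hs1 : s < 1) :
    PrekopaLeindlerIneq s (fun x y => (x - y) ^ 2) (gaussianReal 0 1) := by
  have hs1' : 0 < 1 - s := by linarith
  intro u v r hu hv h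
  have hg := measurable_gaussianPDF 0 1
  rw [gaussianReal_of_var_ne_zero _ one_ne_zero, lintegral_withDensity_eq_lintegral_mul _ hg hu,
    lintegral_withDensity_eq_lintegral_mul _ hg hv]
  have hK : ∫⁻ x, ENNReal.ofReal (Real.exp r) * gaussianPDF 0 1 x
      = ENNReal.ofReal (Real.exp r) := by
    rw [lintegral_const_mul _ hg, lintegral_gaussianPDF_eq_one _ one_ne_zero, mul_one]
  rw [← hK]
  refine prekopaLeindler_real hs0 hs1 (hg.mul hu) (hg.mul hv) (hg.const_mul _) fun x y => ?_
  have hφ : gaussianPDF 0 1 x ^ (1 - s) * gaussianPDF 0 1 y ^ s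
      * ENNReal.ofReal (Real.exp (s * (1 - s) / 2 * (x - y) ^ 2 + r)) =
      ENNReal.ofReal (Real.exp r) * gaussianPDF 0 1 ((1 - s) * x + s * y) := by
    simp only [gaussianPDF]
    have hp : ∀ z, 0 < gaussianPDFReal 0 1 z := fun z => gaussianPDFReal_pos _ _ _ one_ne_zero
    rw [ENNReal.ofReal_rpow_of_pos (hp x), ENNReal.ofReal_rpow_of_pos (hp y),
      ← ENNReal.ofReal_mul (by have := hp x; positivity), ← ENNReal.ofReal_mul
        (by have := hp x; have := hp y; positivity), ← ENNReal.ofReal_mul (by positivity)]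
    congr 1
    simp only [gaussianPDFReal, sub_zero, NNReal.coe_one, mul_one]
    have hq : 0 < (√(2 * Real.pi))⁻¹ := by positivity
    rw [Real.mul_rpow hq.le (Real.exp_nonneg _), Real.mul_rpow hq.le (Real.exp_nonneg _),
      ← Real.exp_mul, ← Real.exp_mul]
    have : (√(2 * Real.pi))⁻¹ ^ (1 - s) * (√(2 * Real.pi))⁻¹ ^ s = (√(2 * Real.pi))⁻¹ := by
      rw [← Real.rpow_add hq]; simp
    calc _ = ((√(2 * Real.pi))⁻¹ ^ (1 - s) * (√(2 * Real.pi))⁻¹ ^ s) *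
          (Real.exp (-x ^ 2 / 2 * (1 - s)) * Real.exp (-y ^ 2 / 2 * s) *
            Real.exp (s * (1 - s) / 2 * (x - y) ^ 2 + r)) := by ring
      _ = (√(2 * Real.pi))⁻¹ * (Real.exp r * Real.exp (-((1 - s) * x + s * y) ^ 2 / 2)) := by
          rw [this, ← Real.exp_add, ← Real.exp_add, ← Real.exp_add]
          congr 2
          ring
      _ = _ := by ring
  simp only [Pi.mul_apply]
  rw [ENNReal.mul_rpow_of_nonneg _ _ hs1'.le, ENNReal.mul_rpow_of_nonneg _ _ hs0.le, ← hφ]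
  calc _ = gaussianPDF 0 1 x ^ (1 - s) * gaussianPDF 0 1 y ^ s * (u x ^ (1 - s) * v y ^ s) := by
        ring
    _ ≤ _ := by gcongr; exact h x y

lemma prekopaLeindlerIneq_stdGaussian {s : ℝ} (hs0 : 0 < s) (hs1 : s < 1) (n : ℕ) :
    PrekopaLeindlerIneq s (fun x y : StateSpace n => dist x y ^ 2)
      (stdGaussian (StateSpace n)) := by
  rw [← map_pi_eq_stdGaussian]
  refine ((prekopaLeindlerIneq_gaussianReal hs0 hs1).pi hs0 hs1 n).map hs0 hs1
    (by fun_prop) fun x y => le_of_eq ?_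
  rw [EuclideanSpace.dist_eq, Real.sq_sqrt (by positivity)]
  simp [Real.dist_eq, sq_abs]

/-! ### Sub-Gaussian bounds for Lipschitz functions -/

section Laplace

variable {X : Type*} [MeasurableSpace X] {μ : Measure X} [IsProbabilityMeasure μ] {c : X → X → ℝ}

omit [IsProbabilityMeasure μ] in
/-- The inequality with `v = exp G` and `u = exp (-(s / (1 - s)) G)`; the constant
completes the square in `L √c ≤ (1 - s) c / 2 + L² / (2 (1 - s))`. -/
lemma PrekopaLeindlerIneq.lintegral_exp_le {s : ℝ} (hs0 : 0 < s) (hs1 : s < 1)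
    (hμ : PrekopaLeindlerIneq s c μ) (hc : ∀ x y, 0 ≤ c x y) {G : X → ℝ} (hG : Measurable G)
    {L : ℝ} (hL : ∀ x y, G y - G x ≤ L * √(c x y)) :
    (∫⁻ x, ENNReal.ofReal (Real.exp (-(s / (1 - s)) * G x)) ∂μ) ^ (1 - s)
      * (∫⁻ x, ENNReal.ofReal (Real.exp (G x)) ∂μ) ^ s
      ≤ ENNReal.ofReal (Real.exp (s * (L ^ 2 / (2 * (1 - s))))) := by
  have hs1' : 0 < 1 - s := by linarith
  refine hμ _ _ _ (by fun_prop) (by fun_prop) fun x y => ?_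
  rw [ENNReal.ofReal_rpow_of_pos (Real.exp_pos _), ENNReal.ofReal_rpow_of_pos (Real.exp_pos _),
    ← ENNReal.ofReal_mul (by positivity), ← Real.exp_mul, ← Real.exp_mul, ← Real.exp_add]
  refine ENNReal.ofReal_le_ofReal (Real.exp_le_exp.2 ?_)
  have h1 : -(s / (1 - s)) * G x * (1 - s) + G y * s = s * (G y - G x) := by field_simp; ring
  have h2 : s * (1 - s) / 2 * c x y + s * (L ^ 2 / (2 * (1 - s))) - s * (L * √(c x y))
      = s * (1 - s) / 2 * (√(c x y) - L / (1 - s)) ^ 2 := by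
    have := Real.sq_sqrt (hc x y)
    rw [sub_sq, this]
    field_simp
    ring
  have h3 : 0 ≤ s * (1 - s) / 2 * (√(c x y) - L / (1 - s)) ^ 2 := by positivity
  rw [h1]
  nlinarith [mul_le_mul_of_nonneg_left (hL x y) hs0.le]

/-- Lipschitz functions have exponential moments: otherwise the second factor of the inequality
would be infinite, while the first is never zero. -/
lemma integrable_exp_of_prekopaLeindlerIneq
    (hμ : ∀ s, 0 < s → s < 1 → PrekopaLeindlerIneq s c μ) (hc : ∀ x y, 0 ≤ c x y) {G : X → ℝ}
    (hG : Measurable G) {L : ℝ} (hL : ∀ x y, G y - G x ≤ L * √(c x y)) :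
    Integrable (fun x => Real.exp (G x)) μ := by
  -- any weight works here; only finiteness of the second factor is extracted
  have h := (hμ (1 / 2) (by norm_num) (by norm_num)).lintegral_exp_le (by norm_num) (by norm_num)
    hc hG hL
  refine ⟨by fun_prop, ?_⟩
  rw [hasFiniteIntegral_iff_ofReal (Filter.Eventually.of_forall fun x => (Real.exp_pos _).le)]
  rw [lt_top_iff_ne_top]
  intro htop
  rw [htop, ENNReal.top_rpow_of_pos (by norm_num), ENNReal.mul_top] at h
  · simp at h
  · rw [ne_eq, ENNReal.rpow_eq_zero_iff_of_pos (by norm_num), lintegral_eq_zero_iff (by fun_prop)]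
    intro h0
    have : ∀ᵐ x ∂μ, False := by
      filter_upwards [h0] with x hx
      simp [not_le.2 (Real.exp_pos _)] at hx
    exact IsProbabilityMeasure.ne_zero μ (by simpa using this)

/-- The sharp Laplace transform bound for functions that are `L`-Lipschitz for the distance `√c`.
Each `s` gives the bound with `L² / (1 - s)` in place of `L²`. -/
theorem hasSubgaussianMGF_of_prekopaLeindlerIneq
    (hμ : ∀ s, 0 < s → s < 1 → PrekopaLeindlerIneq s c μ) (hc : ∀ x y, 0 ≤ c x y) {G : X → ℝ}
    (hG : Measurable G) {L : NNReal} (hL : ∀ x y, |G y - G x| ≤ L * √(c x y)) :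
    Integrable G μ ∧ HasSubgaussianMGF (fun x => G x - ∫ z, G z ∂μ) (L ^ 2) μ := by
  have hLt : ∀ t x y, t * G y - t * G x ≤ (|t| * L) * √(c x y) := fun t x y => by
    rw [← mul_sub, mul_assoc]
    exact (le_abs_self _).trans
      ((abs_mul _ _).trans_le (mul_le_mul_of_nonneg_left (hL x y) (abs_nonneg t)))
  have hexp : ∀ t, Integrable (fun x => Real.exp (t * G x)) μ := fun t =>
    integrable_exp_of_prekopaLeindlerIneq hμ hc (hG.const_mul t) (hLt t)
  have hGi : Integrable G μ := by
    simpa using integrable_pow_of_integrable_exp_mul one_ne_zero (hexp 1) (hexp (-1)) 1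
  have hexp_sub : ∀ t x, Real.exp (t * (G x - ∫ z, G z ∂μ))
      = Real.exp (t * G x) * Real.exp (-(t * ∫ z, G z ∂μ)) := fun t x => by
    rw [← Real.exp_add]; ring_nf
  refine ⟨hGi, ⟨fun t => ?_, fun t => ?_⟩⟩
  · simp only [hexp_sub]
    exact (hexp t).mul_const _
  have hpos : 0 < ∫ x, Real.exp (t * G x) ∂μ := integral_exp_pos (hexp t)
  -- Jensen's inequality for the factor `exp (-(s / (1 - s)) t G)`
  have key : ∀ s, 0 < s → s < 1 → Real.log (∫ x, Real.exp (t * G x) ∂μ) - t * ∫ x, G x ∂μ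
      ≤ (|t| * L) ^ 2 / (2 * (1 - s)) := by
    intro s hs0 hs1
    have hs1' : 0 < 1 - s := by linarith
    have h := (hμ s hs0 hs1).lintegral_exp_le hs0 hs1 hc (hG.const_mul t) (hLt t)
    simp only [← mul_assoc] at h
    rw [← ofReal_integral_eq_lintegral_ofReal (hexp t)
        (Filter.Eventually.of_forall fun x => (Real.exp_pos _).le),
      ← ofReal_integral_eq_lintegral_ofReal (hexp _)
        (Filter.Eventually.of_forall fun x => (Real.exp_pos _).le),
      ENNReal.ofReal_rpow_of_pos (integral_exp_pos (hexp _)), ENNReal.ofReal_rpow_of_pos hpos,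
      ← ENNReal.ofReal_mul (by positivity), ENNReal.ofReal_le_ofReal_iff (Real.exp_pos _).le] at h
    have hJ : Real.exp (∫ x, -(s / (1 - s)) * t * G x ∂μ)
        ≤ ∫ x, Real.exp (-(s / (1 - s)) * t * G x) ∂μ :=
      convexOn_exp.map_integral_le Real.continuous_exp.continuousOn isClosed_univ
        (by simp) (hGi.const_mul _) (hexp _)
    have h2 := Real.log_le_log (by positivity)
      ((mul_le_mul_of_nonneg_right (Real.rpow_le_rpow (Real.exp_pos _).le hJ hs1'.le)
        (by positivity)).trans h)
    rw [Real.log_mul (by positivity) (by positivity), Real.log_rpow (Real.exp_pos _),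
      Real.log_rpow hpos, Real.log_exp, Real.log_exp, integral_const_mul] at h2
    have h3 : (1 - s) * (-(s / (1 - s)) * t * ∫ x, G x ∂μ) = s * (-(t * ∫ x, G x ∂μ)) := by
      field_simp
    rw [h3, ← mul_add] at h2
    linarith [le_of_mul_le_mul_left h2 hs0]
  have hlim : Real.log (∫ x, Real.exp (t * G x) ∂μ) - t * ∫ x, G x ∂μ ≤ (|t| * L) ^ 2 / 2 := by
    have ht : Filter.Tendsto (fun s : ℝ => (|t| * L) ^ 2 / (2 * (1 - s)))
        (nhdsWithin 0 (Set.Ioi 0)) (nhds ((|t| * L) ^ 2 / (2 * (1 - 0)))) := by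
      refine Filter.Tendsto.mono_left (ContinuousAt.tendsto ?_) nhdsWithin_le_nhds
      refine ContinuousAt.div (by fun_prop) (by fun_prop) (by norm_num)
    rw [sub_zero, mul_one] at ht
    refine ge_of_tendsto ht ?_
    filter_upwards [Ioo_mem_nhdsGT (zero_lt_one (α := ℝ))] with s hs using key s hs.1 hs.2
  simp only [mgf, hexp_sub]
  rw [integral_mul_const, ← Real.exp_log hpos, ← Real.exp_add]
  refine Real.exp_le_exp.2 ?_
  rw [mul_pow, sq_abs] at hlim
  push_cast
  linarith

end Laplace

/-! ### Kantorovich duality -/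

/-- Kantorovich duality for the finite transport problem. If no plan has cost at most `C`, then the
compact set of triples (first marginal, second marginal, cost) of all plans is strictly separated
from the closed half-line `{a} × {b} × (-∞, C]`, and the separating functional provides the
potentials. -/
theorem exists_transportPlan_of_duality {ι : Type*} [Fintype ι] {a b : ι → ℝ}
    (ha : a ∈ stdSimplex ℝ ι) (hb : b ∈ stdSimplex ℝ ι) (d : ι → ι → ℝ) (C : ℝ)
    (h : ∀ φ ψ : ι → ℝ, (∀ i j, φ i + ψ j ≤ d i j) → ∑ i, a i * φ i + ∑ j, b j * ψ j ≤ C) :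
    ∃ w : ι × ι → ℝ, (∀ z, 0 ≤ w z) ∧ (∀ i, ∑ j, w (i, j) = a i) ∧ (∀ j, ∑ i, w (i, j) = b j) ∧
      ∑ z, w z * d z.1 z.2 ≤ C := by
  classical
  let T : (ι × ι → ℝ) →ₗ[ℝ] (ι → ℝ) × (ι → ℝ) × ℝ :=
    { toFun := fun w => (fun i => ∑ j, w (i, j), fun j => ∑ i, w (i, j), ∑ z, w z * d z.1 z.2)
      map_add' := fun w w' => by
        ext <;> simp [Finset.sum_add_distrib, add_mul]
      map_smul' := fun r w => by
        ext <;> simp [Finset.mul_sum, mul_assoc] }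
  by_contra hcon
  have hT : Continuous T := T.continuous_of_finiteDimensional
  have hdisj : Disjoint (T '' stdSimplex ℝ (ι × ι)) ({a} ×ˢ ({b} ×ˢ Set.Iic C)) := by
    rw [Set.disjoint_left]
    rintro _ ⟨w, hw, rfl⟩ ⟨h1, h2, h3⟩
    exact hcon ⟨w, hw.1, fun i => congrFun h1 i, fun j => congrFun h2 j, h3⟩
  obtain ⟨f, u, v, hu, huv, hv⟩ := geometric_hahn_banach_compact_closed
    ((convex_stdSimplex ℝ (ι × ι)).linear_image T) ((isCompact_stdSimplex ℝ (ι × ι)).image hT)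
    ((convex_singleton a).prod ((convex_singleton b).prod (convex_Iic C)))
    (isClosed_singleton.prod (isClosed_singleton.prod isClosed_Iic)) hdisj
  -- coordinates of the separating functional
  set α : ι → ℝ := fun i => f (Pi.single i 1, 0, 0) with hα
  set β : ι → ℝ := fun j => f (0, Pi.single j 1, 0) with hβ
  set τ : ℝ := f (0, 0, 1) with hτ
  have hf : ∀ x y t, f (x, y, t) = ∑ i, x i * α i + ∑ j, y j * β j + t * τ := by
    intro x y t
    have e : (x, y, t) = ∑ i, x i • ((Pi.single i 1, 0, 0) : (ι → ℝ) × (ι → ℝ) × ℝ)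
        + ∑ j, y j • ((0, Pi.single j 1, 0) : (ι → ℝ) × (ι → ℝ) × ℝ)
        + t • ((0, 0, 1) : (ι → ℝ) × (ι → ℝ) × ℝ) := by
      ext k
      · simp [Prod.fst_sum, Finset.sum_apply, Pi.single_apply]
      · simp [Prod.fst_sum, Prod.snd_sum, Finset.sum_apply, Pi.single_apply]
      · simp [Prod.snd_sum]
    rw [e]
    simp only [map_add, map_sum, map_smul, smul_eq_mul, α, β, τ]
  have hsep : ∀ i j, α i + β j + d i j * τ < u := by
    intro i j
    have := hu _ ⟨Pi.single (i, j) 1, single_mem_stdSimplex ℝ (i, j), rfl⟩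
    have e : T (Pi.single (i, j) 1) = (Pi.single i 1, Pi.single j 1, d i j) := by
      ext k
      · simp [T, Pi.single_apply, Prod.ext_iff, ite_and]
      · simp [T, Pi.single_apply, Prod.ext_iff, ite_and]
      · simp [T, Pi.single_apply]
    rw [e, hf] at this
    simpa [Pi.single_apply] using this
  have hray : ∀ t ≤ C, v < ∑ i, a i * α i + ∑ j, b j * β j + t * τ := fun t ht => by
    rw [← hf]
    exact hv _ ⟨rfl, rfl, ht⟩
  have hτ0 : τ ≤ 0 := by
    by_contra! hpos
    set r := ∑ i, a i * α i + ∑ j, b j * β j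
    have := hray (min C ((v - r) / τ)) (min_le_left _ _)
    have h2 : min C ((v - r) / τ) * τ ≤ v - r := by
      rw [← le_div_iff₀ hpos]
      exact min_le_right _ _
    linarith
  have havg : ∑ i, a i * α i + ∑ j, b j * β j = ∑ i, ∑ j, a i * b j * (α i + β j) := by
    have h1 : ∑ i, ∑ j, a i * b j * α i = ∑ i, a i * α i := by
      refine Finset.sum_congr rfl fun i _ => ?_
      rw [← Finset.sum_mul, ← Finset.mul_sum, hb.2, mul_one]
    have h2 : ∑ i, ∑ j, a i * b j * β j = ∑ j, b j * β j := by
      rw [Finset.sum_comm]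
      refine Finset.sum_congr rfl fun j _ => ?_
      rw [← Finset.sum_mul, ← Finset.sum_mul, ha.2, one_mul]
    simp only [mul_add, Finset.sum_add_distrib, h1, h2]
  rcases hτ0.eq_or_lt with h0 | hneg
  · have h1 : ∑ i, ∑ j, a i * b j * (α i + β j) ≤ ∑ i, ∑ j, a i * b j * u := by
      refine Finset.sum_le_sum fun i _ => Finset.sum_le_sum fun j _ =>
        mul_le_mul_of_nonneg_left ?_ (mul_nonneg (ha.1 i) (hb.1 j))
      simpa [h0] using (hsep i j).le
    have h2 : ∑ i, ∑ j, a i * b j * u = u := by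
      simp [← Finset.sum_mul, ← Finset.mul_sum, hb.2, ha.2]
    have h3 := hray C le_rfl
    rw [h0, mul_zero, add_zero, havg] at h3
    linarith
  · have hσ : 0 < -τ := by linarith
    have h1 := h (fun i => (α i - u) / (-τ)) (fun j => β j / (-τ)) (fun i j => by
      rw [← add_div, div_le_iff₀ hσ]
      linarith [hsep i j])
    have h2 : ∑ i, a i * ((α i - u) / (-τ)) + ∑ j, b j * (β j / (-τ))
        = (∑ i, a i * α i + ∑ j, b j * β j - u) / (-τ) := by
      have : ∑ i, a i * (α i - u) = ∑ i, a i * α i - u := by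
        simp only [mul_sub, Finset.sum_sub_distrib, ← Finset.sum_mul, ha.2, one_mul]
      simp only [← mul_div_assoc]
      rw [← Finset.sum_div, ← Finset.sum_div, this]
      ring
    rw [h2, div_le_iff₀ hσ] at h1
    linarith [hray C le_rfl]

section Quantization

variable {X : Type*} [MeasurableSpace X] {d : X → X → ℝ}

/-- A discrete plan `w` between the cells of a finite partition lifts to the coupling
`∑ w (i, j) μ[· | cell i] ⊗ ν[· | cell j]`. -/
lemma exists_coupling_of_transportPlan {ι : Type*} [Fintype ι] (μ ν : Measure X)
    [IsProbabilityMeasure μ] [IsProbabilityMeasure ν] {q : X → ι}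
    (hq : ∀ i, MeasurableSet (q ⁻¹' {i})) {w : ι × ι → ℝ} (hw : ∀ z, 0 ≤ w z)
    (hwa : ∀ i, ∑ j, w (i, j) = μ.real (q ⁻¹' {i}))
    (hwb : ∀ j, ∑ i, w (i, j) = ν.real (q ⁻¹' {j})) :
    ∃ π : Measure (X × X), π.fst = μ ∧ π.snd = ν ∧
      ∀ e : ι → ι → ℝ≥0∞, ∫⁻ z, e (q z.1) (q z.2) ∂π
        ≤ ∑ z, ENNReal.ofReal (w z) * e z.1 z.2 := by
  classical
  set π : Measure (X × X) := ∑ z : ι × ι,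
    ENNReal.ofReal (w z) • (μ[|q ⁻¹' {z.1}]).prod (ν[|q ⁻¹' {z.2}]) with hπ
  have hw0 : ∀ i j, (μ (q ⁻¹' {i}) = 0 ∨ ν (q ⁻¹' {j}) = 0) → w (i, j) = 0 := by
    rintro i j (h | h)
    · have h1 := hwa i
      rw [measureReal_def, h, ENNReal.toReal_zero,
        Finset.sum_eq_zero_iff_of_nonneg fun j _ => hw _] at h1
      exact h1 j (Finset.mem_univ _)
    · have h1 := hwb j
      rw [measureReal_def, h, ENNReal.toReal_zero,
        Finset.sum_eq_zero_iff_of_nonneg fun j _ => hw _] at h1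
      exact h1 i (Finset.mem_univ _)
  have hpart : ∀ (ρ : Measure X) [IsProbabilityMeasure ρ] (s : Set X), MeasurableSet s →
      ∑ i, ρ (q ⁻¹' {i}) * ρ[|q ⁻¹' {i}] s = ρ s := by
    intro ρ _ s hs
    have h1 : ∀ i, ρ (q ⁻¹' {i}) * ρ[|q ⁻¹' {i}] s = ρ (q ⁻¹' {i} ∩ s) := fun i => by
      rw [mul_comm, cond_mul_eq_inter (hq i) s]
    simp only [h1]
    rw [← measure_biUnion_finset]
    · congr 1
      ext x
      simp
    · intro i _ j _ hij
      refine Set.disjoint_left.2 ?_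
      rintro x ⟨hx, -⟩ ⟨hx', -⟩
      exact hij (hx.symm.trans hx')
    · exact fun i _ => (hq i).inter hs
  refine ⟨π, ?_, ?_, fun e => ?_⟩
  · ext s hs
    rw [Measure.fst_apply hs, hπ, Measure.finsetSum_apply, Fintype.sum_prod_type, ← hpart μ s hs]
    refine Finset.sum_congr rfl fun i _ => ?_
    rw [← ofReal_measureReal, ← hwa i, ENNReal.ofReal_sum_of_nonneg fun j _ => hw _, Finset.sum_mul]
    refine Finset.sum_congr rfl fun j _ => ?_
    rcases eq_or_ne (ν (q ⁻¹' {j})) 0 with h0 | h0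
    · simp [hw0 i j (Or.inr h0)]
    have := cond_isProbabilityMeasure h0
    rw [Measure.smul_apply, ← Set.prod_univ, Measure.prod_prod]
    simp
  · ext s hs
    rw [Measure.snd_apply hs, hπ, Measure.finsetSum_apply, Fintype.sum_prod_type_right,
      ← hpart ν s hs]
    refine Finset.sum_congr rfl fun j _ => ?_
    rw [← ofReal_measureReal, ← hwb j, ENNReal.ofReal_sum_of_nonneg fun i _ => hw _, Finset.sum_mul]
    refine Finset.sum_congr rfl fun i _ => ?_
    rcases eq_or_ne (μ (q ⁻¹' {i})) 0 with h0 | h0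
    · simp [hw0 i j (Or.inl h0)]
    have := cond_isProbabilityMeasure h0
    rw [Measure.smul_apply, ← Set.univ_prod, Measure.prod_prod]
    simp
  · rw [hπ, lintegral_finsetSum_measure]
    refine Finset.sum_le_sum fun z _ => ?_
    rw [lintegral_smul_measure, smul_eq_mul]
    refine mul_le_mul_right ?_ _
    have h1 : ∀ᵐ x ∂(μ[|q ⁻¹' {z.1}]).prod (ν[|q ⁻¹' {z.2}]), q x.1 = z.1 :=
      Measure.quasiMeasurePreserving_fst.ae (ae_cond_mem (hq z.1))
    have h2 : ∀ᵐ x ∂(μ[|q ⁻¹' {z.1}]).prod (ν[|q ⁻¹' {z.2}]), q x.2 = z.2 :=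
      Measure.quasiMeasurePreserving_snd.ae (ae_cond_mem (hq z.2))
    calc _ = ∫⁻ _, e z.1 z.2 ∂(μ[|q ⁻¹' {z.1}]).prod (ν[|q ⁻¹' {z.2}]) := by
          refine lintegral_congr_ae ?_
          filter_upwards [h1, h2] with x hx1 hx2
          rw [hx1, hx2]
      _ ≤ e z.1 z.2 * 1 := by
          rw [lintegral_const]
          gcongr
          rw [← Set.univ_prod_univ, Measure.prod_prod]
          exact mul_le_one' prob_le_one prob_le_one
      _ = _ := mul_one _

/-- Kantorovich duality up to a quantization error. The map `p ∘ q` takes finitely many values. -/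
theorem wassersteinDist_le_of_quantization (hself : ∀ x, d x x = 0) (hsymm : ∀ x y, d x y = d y x)
    (htri : ∀ x y z, d x z ≤ d x y + d y z) (hd : Measurable fun z : X × X => d z.1 z.2)
    {ι : Type*} [Fintype ι] (μ ν : Measure X)
    [IsProbabilityMeasure μ] [IsProbabilityMeasure ν] {q : X → ι}
    (hq : ∀ i, MeasurableSet (q ⁻¹' {i})) (p : ι → X) {C : ℝ}
    (H : ∀ g : X → ℝ, Measurable g → (∀ x y, |g x - g y| ≤ d x y) →
      ∫ x, g (p (q x)) ∂μ - ∫ x, g (p (q x)) ∂ν ≤ C) :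
    wassersteinDist d μ ν ≤ ∫⁻ x, ENNReal.ofReal (d x (p (q x))) ∂μ + ENNReal.ofReal C
      + ∫⁻ x, ENNReal.ofReal (d x (p (q x))) ∂ν := by
  classical
  have : Nonempty ι := (nonempty_of_isProbabilityMeasure μ).map q
  have hd0 : ∀ x y, 0 ≤ d x y := fun x y => by
    have := htri x y x
    rw [hself, hsymm y x] at this
    linarith
  let _ : MeasurableSpace ι := ⊤
  have hqm : Measurable q := measurable_to_countable' hq
  have hint : ∀ (ρ : Measure X) [IsProbabilityMeasure ρ] (f : ι → ℝ),
      ∫ x, f (q x) ∂ρ = ∑ i, ρ.real (q ⁻¹' {i}) * f i := fun ρ _ f => by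
    have hfin : IsProbabilityMeasure (ρ.map q) := Measure.isProbabilityMeasure_map hqm.aemeasurable
    rw [← integral_map (f := f) hqm.aemeasurable (measurable_of_finite f).aestronglyMeasurable,
      integral_fintype .of_finite]
    simp [map_measureReal_apply hqm]
  have hsimplex : ∀ (ρ : Measure X) [IsProbabilityMeasure ρ],
      (fun i => ρ.real (q ⁻¹' {i})) ∈ stdSimplex ℝ ι := fun ρ _ => by
    refine ⟨fun _ => measureReal_nonneg, ?_⟩
    simpa using (hint ρ fun _ => 1).symm
  obtain ⟨w, hw, hwa, hwb, hcost⟩ := exists_transportPlan_of_duality (hsimplex μ) (hsimplex ν)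
    (fun i j => d (p i) (p j)) C (fun φ ψ hφψ => by
      -- the `d`-transform of `ψ` is a Lipschitz function which improves both potentials
      set g : X → ℝ := fun x => ⨅ j, (d x (p j) - ψ j) with hg
      have hgle : ∀ x j, g x ≤ d x (p j) - ψ j := fun x j =>
        ciInf_le (Set.finite_range _).bddBelow j
      have hgm : Measurable g :=
        Measurable.iInf fun j => (hd.comp measurable_prodMk_right).sub_const _
      have hg1 : ∀ x y, g x - g y ≤ d x y := fun x y => by
        have : g x - d x y ≤ g y := le_ciInf fun j => by
          linarith [hgle x j, htri x y (p j)]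
        linarith
      have h1 := H g hgm fun x y => abs_sub_le_iff.2 ⟨hg1 x y, hsymm x y ▸ hg1 y x⟩
      rw [hint μ fun i => g (p i), hint ν fun i => g (p i)] at h1
      have h2 : ∑ i, μ.real (q ⁻¹' {i}) * φ i ≤ ∑ i, μ.real (q ⁻¹' {i}) * g (p i) :=
        Finset.sum_le_sum fun i _ => mul_le_mul_of_nonneg_left
          (le_ciInf fun j => by linarith [hφψ i j]) measureReal_nonneg
      have h3 : ∑ i, ν.real (q ⁻¹' {i}) * g (p i) ≤ ∑ i, ν.real (q ⁻¹' {i}) * (-ψ i) :=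
        Finset.sum_le_sum fun i _ => mul_le_mul_of_nonneg_left
          (by simpa [hself] using hgle (p i) i) measureReal_nonneg
      simp only [mul_neg, Finset.sum_neg_distrib] at h3
      linarith)
  obtain ⟨π, hπ1, hπ2, hπ3⟩ := exists_coupling_of_transportPlan μ ν hq hw hwa hwb
  have hpq : Measurable fun x => p (q x) := (measurable_from_top (f := p)).comp hqm
  have hm : Measurable fun x => ENNReal.ofReal (d x (p (q x))) :=
    (hd.comp (measurable_id.prodMk hpq)).ennreal_ofReal
  calc wassersteinDist d μ ν ≤ ∫⁻ z, ENNReal.ofReal (d z.1 z.2) ∂π := iInf₂_le π ⟨hπ1, hπ2⟩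
    _ ≤ ∫⁻ z, ENNReal.ofReal (d z.1 (p (q z.1)))
        + ENNReal.ofReal (d (p (q z.1)) (p (q z.2))) + ENNReal.ofReal (d z.2 (p (q z.2))) ∂π := by
      refine lintegral_mono fun z => ?_
      rw [← ENNReal.ofReal_add (hd0 _ _) (hd0 _ _),
        ← ENNReal.ofReal_add (add_nonneg (hd0 _ _) (hd0 _ _)) (hd0 _ _)]
      refine ENNReal.ofReal_le_ofReal ?_
      have h1 := htri z.1 (p (q z.1)) z.2
      have h2 := htri (p (q z.1)) (p (q z.2)) z.2
      rw [hsymm (p (q z.2)) z.2] at h2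
      linarith
    _ = ∫⁻ z, ENNReal.ofReal (d z.1 (p (q z.1))) ∂π
        + ∫⁻ z, ENNReal.ofReal (d (p (q z.1)) (p (q z.2))) ∂π
        + ∫⁻ z, ENNReal.ofReal (d z.2 (p (q z.2))) ∂π := by
      have hm1 : Measurable fun z : X × X => ENNReal.ofReal (d z.1 (p (q z.1))) :=
        hm.comp measurable_fst
      have hm2 : Measurable fun z : X × X => ENNReal.ofReal (d z.2 (p (q z.2))) :=
        hm.comp measurable_snd
      rw [lintegral_add_right _ hm2, lintegral_add_left hm1]
    _ ≤ _ := by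
      gcongr
      · rw [← hπ1, Measure.fst, lintegral_map hm measurable_fst]
      · refine (hπ3 fun i j => ENNReal.ofReal (d (p i) (p j))).trans ?_
        simp only [← ENNReal.ofReal_mul (hw _)]
        rw [← ENNReal.ofReal_sum_of_nonneg fun z _ => mul_nonneg (hw z) (hd0 _ _)]
        exact ENNReal.ofReal_le_ofReal hcost
      · rw [← hπ2, Measure.snd, lintegral_map hm measurable_snd]

end Quantization

/-! ### Entropy and the Bobkov–Götze criterion -/

section Entropy

variable {X : Type*} [MeasurableSpace X] {μ ν : Measure X} [IsProbabilityMeasure μ]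
  [IsProbabilityMeasure ν]

/-- A function with an exponential moment under `μ` is integrable under every measure of finite
entropy, by Young's inequality `r f ≤ (r log r - r) + exp f`. -/
lemma integrable_of_klDiv_ne_top (h : klDiv ν μ ≠ ∞) {f : X → ℝ} (hf : Measurable f)
    (hf0 : ∀ x, 0 ≤ f x) (hexp : Integrable (fun x => Real.exp (f x)) μ) : Integrable f ν := by
  obtain ⟨hac, -⟩ := klDiv_ne_top_iff.1 h
  refine ⟨hf.aestronglyMeasurable, ?_⟩
  rw [hasFiniteIntegral_iff_ofReal (Filter.Eventually.of_forall hf0),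
    ← lintegral_rnDeriv_mul hac hf.ennreal_ofReal.aemeasurable]
  have hle : ∫⁻ x, ν.rnDeriv μ x * ENNReal.ofReal (f x) ∂μ
      ≤ ∫⁻ x, ENNReal.ofReal (klFun (ν.rnDeriv μ x).toReal)
        + ENNReal.ofReal (Real.exp (f x)) ∂μ := by
    refine lintegral_mono_ae ?_
    filter_upwards [ν.rnDeriv_lt_top μ] with x hx
    set r := (ν.rnDeriv μ x).toReal with hr
    have hr0 : 0 ≤ r := ENNReal.toReal_nonneg
    rw [← ENNReal.ofReal_toReal hx.ne, ← hr, ← ENNReal.ofReal_mul hr0,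
      ← ENNReal.ofReal_add (klFun_nonneg hr0) (Real.exp_pos _).le]
    refine ENNReal.ofReal_le_ofReal ?_
    rcases hr0.eq_or_lt with h0 | hpos
    · rw [← h0, klFun_zero]
      have := Real.exp_pos (f x)
      linarith
    · have h1 := Real.add_one_le_exp (f x - Real.log r)
      rw [Real.exp_sub, Real.exp_log hpos, le_div_iff₀ hpos] at h1
      rw [klFun_apply]
      nlinarith
  refine hle.trans_lt ?_
  rw [lintegral_add_right _ (by fun_prop), ← klDiv_eq_lintegral_klFun_of_ac hac]
  refine ENNReal.add_lt_top.2 ⟨lt_top_iff_ne_top.2 h, ?_⟩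
  rw [← hasFiniteIntegral_iff_ofReal (Filter.Eventually.of_forall fun x => (Real.exp_pos _).le)]
  exact hexp.2

/-- The Gibbs variational inequality: the difference of the two sides is the relative entropy of
`ν` with respect to the exponential tilt of `μ` by `F`. -/
lemma integral_le_klDiv_add_log_integral_exp (h : klDiv ν μ ≠ ∞) {F : X → ℝ} (hF : Integrable F ν)
    (hexp : Integrable (fun x => Real.exp (F x)) μ) :
    ∫ x, F x ∂ν ≤ (klDiv ν μ).toReal + Real.log (∫ x, Real.exp (F x) ∂μ) := by
  obtain ⟨hac, hint⟩ := klDiv_ne_top_iff.1 h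
  have : IsProbabilityMeasure (μ.tilted F) := isProbabilityMeasure_tilted hexp
  have h1 := toReal_klDiv_of_measure_eq (hac.trans (absolutelyContinuous_tilted hexp)) (by simp)
  rw [integral_llr_tilted_right hac hF hexp hint,
    ← toReal_klDiv_of_measure_eq hac (by simp)] at h1
  have h2 : 0 ≤ (klDiv ν (μ.tilted F)).toReal := ENNReal.toReal_nonneg
  linarith

/-- Sub-Gaussian functions have means that are stable under changes of measure of finite entropy:
optimize the Gibbs inequality for `t (g - ∫ g dμ)` over `t > 0`. -/
lemma integral_sub_integral_le_sqrt_klDiv (h : klDiv ν μ ≠ ∞) {g : X → ℝ} (hg : Integrable g ν)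
    {C : NNReal} (hC : 0 < C) (hsub : HasSubgaussianMGF (fun x => g x - ∫ z, g z ∂μ) C μ) :
    ∫ x, g x ∂ν - ∫ x, g x ∂μ ≤ √(2 * C * (klDiv ν μ).toReal) := by
  set δ := ∫ x, g x ∂ν - ∫ x, g x ∂μ with hδ
  rcases le_or_gt δ 0 with h0 | hpos
  · exact h0.trans (Real.sqrt_nonneg _)
  have hC' : (0 : ℝ) < C := hC
  -- the optimal parameter is `t = δ / C`
  have key : ∀ t : ℝ, t * δ ≤ (klDiv ν μ).toReal + C * t ^ 2 / 2 := fun t => by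
    have h1 := integral_le_klDiv_add_log_integral_exp h
      (F := fun x => t * (g x - ∫ z, g z ∂μ)) ((hg.sub (integrable_const _)).const_mul t)
      (hsub.integrable_exp_mul t)
    have h2 : Real.log (∫ x, Real.exp (t * (g x - ∫ z, g z ∂μ)) ∂μ) ≤ C * t ^ 2 / 2 :=
      (Real.log_le_iff_le_exp (integral_exp_pos (hsub.integrable_exp_mul t))).2 (hsub.mgf_le t)
    rw [integral_const_mul, integral_sub hg (integrable_const _)] at h1
    simp only [integral_const, probReal_univ, one_smul] at h1
    linarith
  refine Real.le_sqrt_of_sq_le ?_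
  have h1 := key (δ / C)
  have h2 : δ / C * δ = δ ^ 2 / C := by ring
  have h3 : C * (δ / C) ^ 2 / 2 = δ ^ 2 / C / 2 := by field_simp
  rw [h2, h3] at h1
  have h4 : δ ^ 2 / C ≤ 2 * (klDiv ν μ).toReal := by linarith
  rw [div_le_iff₀ hC'] at h4
  linarith

end Entropy

/-- The Bobkov–Götze criterion: if all functions that are `1`-Lipschitz for `d` are sub-Gaussian
with constant `C`, then the measure satisfies `T₁(C)`. -/
theorem transportEntropyOne_of_hasSubgaussianMGF {X : Type*} [NormedAddCommGroup X]
    [MeasurableSpace X] [BorelSpace X] [SecondCountableTopology X] {d : X → X → ℝ}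
    (hself : ∀ x, d x x = 0) (hsymm : ∀ x y, d x y = d y x)
    (htri : ∀ x y z, d x z ≤ d x y + d y z) (hd : Measurable fun z : X × X => d z.1 z.2)
    (hlower : ∀ x y, ‖x - y‖ ≤ d x y) {K : ℝ} (hupper : ∀ x y, d x y ≤ K * ‖x - y‖)
    (μ : Measure X) [IsProbabilityMeasure μ] {C : NNReal} (hC : 0 < C)
    (hμ : ∀ g : X → ℝ, Measurable g → (∀ x y, |g x - g y| ≤ d x y) →
      Integrable g μ ∧ HasSubgaussianMGF (fun x => g x - ∫ z, g z ∂μ) C μ) :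
    TransportEntropyOne d C μ := by
  refine ⟨hC, fun ν hν => ?_⟩
  rcases eq_or_ne (klDiv ν μ) ∞ with htop | hfin
  · rw [htop, ENNReal.mul_top (by simp [hC.ne']), ENNReal.top_rpow_of_pos (by norm_num)]
    exact le_top
  have hd0 : ∀ x y, 0 ≤ d x y := fun x y => (norm_nonneg _).trans (hlower x y)
  have hdm : ∀ f : X → X, Measurable f → Measurable fun x => d x (f x) := fun f hf =>
    hd.comp (measurable_id.prodMk hf)
  -- the distance to the origin is integrable under both measures
  have hd1 : ∀ x y, |d x 0 - d y 0| ≤ d x y := fun x y => abs_sub_le_iff.2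
    ⟨by linarith [htri x y 0], by linarith [htri y x 0, hsymm x y]⟩
  obtain ⟨hdμ, hdsub⟩ := hμ (fun x => d x 0) (hdm _ measurable_const) hd1
  have hdν : Integrable (fun x => d x 0) ν := by
    refine integrable_of_klDiv_ne_top hfin (hdm _ measurable_const) (fun x => hd0 x 0) ?_
    have := (hdsub.integrable_exp_mul 1).mul_const (Real.exp (∫ z, d z 0 ∂μ))
    simpa [← Real.exp_add] using this
  have hnorm : ∀ ρ : Measure X, Integrable (fun x => d x 0) ρ → Integrable (fun x : X => x) ρ :=
    fun ρ h => h.mono' aestronglyMeasurable_id (Filter.Eventually.of_forall fun x => by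
      simpa using hlower x 0)
  have hlip : ∀ (ρ : Measure X) [IsProbabilityMeasure ρ], Integrable (fun x => d x 0) ρ →
      ∀ g : X → ℝ, Measurable g → (∀ x y, |g x - g y| ≤ d x y) → Integrable g ρ := by
    intro ρ _ hρ g hg hgl
    refine (hρ.add (integrable_const |g 0|)).mono' hg.aestronglyMeasurable
      (Filter.Eventually.of_forall fun x => ?_)
    have h1 := hgl x 0
    have h2 := abs_sub_abs_le_abs_sub (g x) (g 0)
    simp only [Pi.add_apply, Real.norm_eq_abs]
    linarith
  set R := √(2 * C * (klDiv ν μ).toReal) with hR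
  have hmean : ∀ g : X → ℝ, Measurable g → (∀ x y, |g x - g y| ≤ d x y) →
      ∫ x, g x ∂μ - ∫ x, g x ∂ν ≤ R := by
    intro g hg hgl
    have hgl' : ∀ x y, |(-g x) - (-g y)| ≤ d x y := fun x y => by
      rw [neg_sub_neg, abs_sub_comm]; exact hgl x y
    have := integral_sub_integral_le_sqrt_klDiv hfin (hlip ν hdν _ hg.neg hgl') hC
      (hμ _ hg.neg hgl').2
    simp only [Pi.neg_apply, integral_neg] at this
    linarith
  -- quantization by simple functions
  let q : ℕ → SimpleFunc X X := fun n =>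
    SimpleFunc.approxOn (fun x : X => x) measurable_id (Set.range (fun x : X => x) ∪ {0}) 0
      (by simp) n
  set E : Measure X → ℕ → ℝ≥0∞ := fun ρ n => ∫⁻ x, ENNReal.ofReal (d x (q n x)) ∂ρ with hE
  have hElim : ∀ ρ : Measure X, Integrable (fun x => d x 0) ρ →
      Filter.Tendsto (E ρ) Filter.atTop (nhds 0) := by
    intro ρ hρ
    have h1 := SimpleFunc.tendsto_approxOn_range_L1_enorm (f := fun x : X => x) (μ := ρ)
      measurable_id (hnorm ρ hρ)
    have h2 := ENNReal.Tendsto.const_mul (a := ENNReal.ofReal K) h1 (Or.inr ENNReal.ofReal_ne_top)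
    rw [mul_zero] at h2
    refine tendsto_of_tendsto_of_tendsto_of_le_of_le tendsto_const_nhds h2 (fun _ => zero_le)
      fun n => ?_
    simp only [hE]
    rw [← lintegral_const_mul' _ _ ENNReal.ofReal_ne_top]
    refine lintegral_mono fun x => ?_
    rw [← ofReal_norm, ← ENNReal.ofReal_mul' (norm_nonneg _), norm_sub_rev]
    exact ENNReal.ofReal_le_ofReal (hupper _ _)
  have hbound : ∀ n, E μ n ≠ ∞ → E ν n ≠ ∞ →
      wassersteinDist d μ ν ≤ ENNReal.ofReal R + 2 * (E μ n + E ν n) := by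
    intro n h1 h2
    have hquant : ∀ (ρ : Measure X) [IsProbabilityMeasure ρ], Integrable (fun x => d x 0) ρ →
        E ρ n ≠ ∞ → ∀ g : X → ℝ, Measurable g → (∀ x y, |g x - g y| ≤ d x y) →
        |∫ x, g (q n x) ∂ρ - ∫ x, g x ∂ρ| ≤ (E ρ n).toReal := by
      intro ρ _ hρ hEρ g hg hgl
      have hi : Integrable (fun x => g (q n x)) ρ :=
        SimpleFunc.integrable_of_isFiniteMeasure ((q n).map g)
      rw [← integral_sub hi (hlip ρ hρ g hg hgl), ← Real.norm_eq_abs]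
      refine (norm_integral_le_lintegral_norm _).trans (ENNReal.toReal_mono hEρ ?_)
      refine lintegral_mono fun x => ENNReal.ofReal_le_ofReal ?_
      rw [Real.norm_eq_abs, hsymm]
      exact hgl _ _
    have hW := wassersteinDist_le_of_quantization hself hsymm htri hd μ ν
      (q := fun x => (⟨q n x, (q n).mem_range_self x⟩ : (q n).range))
      (fun i => by
        convert (q n).measurableSet_fiber i.1 using 1
        ext x
        simp [Subtype.ext_iff])
      (fun i => i.1) (C := R + (E μ n).toReal + (E ν n).toReal) (fun g hg hgl => by
        have e1 := abs_le.1 (hquant μ hdμ h1 g hg hgl)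
        have e2 := abs_le.1 (hquant ν hdν h2 g hg hgl)
        have e3 := hmean g hg hgl
        simp only
        linarith [e1.2, e2.1])
    refine hW.trans (le_of_eq ?_)
    rw [ENNReal.ofReal_add (by positivity) ENNReal.toReal_nonneg,
      ENNReal.ofReal_add (by positivity) ENNReal.toReal_nonneg, ENNReal.ofReal_toReal h1,
      ENNReal.ofReal_toReal h2]
    simp only [hE]
    ring
  have hW : wassersteinDist d μ ν ≤ ENNReal.ofReal R := by
    have hlim : Filter.Tendsto (fun n => ENNReal.ofReal R + 2 * (E μ n + E ν n)) Filter.atTop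
        (nhds (ENNReal.ofReal R + 2 * (0 + 0))) :=
      tendsto_const_nhds.add (ENNReal.Tendsto.const_mul ((hElim μ hdμ).add (hElim ν hdν))
        (Or.inr (by simp)))
    simp only [add_zero, mul_zero] at hlim
    refine ge_of_tendsto hlim ?_
    filter_upwards [(hElim μ hdμ).eventually_lt_const ENNReal.zero_lt_top,
      (hElim ν hdν).eventually_lt_const ENNReal.zero_lt_top] with n h1 h2
    exact hbound n h1.ne h2.ne
  refine hW.trans (le_of_eq ?_)
  rw [hR, Real.sqrt_eq_rpow, ← ENNReal.ofReal_rpow_of_nonneg (by positivity) (by norm_num),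
    ENNReal.ofReal_mul (by positivity), ENNReal.ofReal_mul (by norm_num),
    ENNReal.ofReal_toReal hfin]
  simp

/-! ### The path as a Lipschitz image of Gaussian noise -/

section Dynamics

variable {n : ℕ} {A : Matrix (Fin n) (Fin n) ℝ}

/-- The trajectory of `y ↦ A y + e` started at `x` and driven by the noise sequence `e`. -/
noncomputable def linearPath (A : Matrix (Fin n) (Fin n) ℝ) (x : StateSpace n)
    (e : ℕ → StateSpace n) : ℕ → StateSpace n
  | 0 => x
  | t + 1 => matrixCLM A (linearPath A x e t) + e t

/-- The first `N` positions `y 1, …, y N` of the trajectory, as a function of the first `N` noise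
vectors; the noise is continued by `0`, which does not affect them. -/
noncomputable def pathMap (A : Matrix (Fin n) (Fin n) ℝ) (x : StateSpace n) (N : ℕ)
    (e : Fin N → StateSpace n) : Fin N → StateSpace n :=
  fun i => linearPath A x (fun k => if h : k < N then e ⟨k, h⟩ else 0) (i + 1)

lemma linearPath_congr (x : StateSpace n) {e e' : ℕ → StateSpace n} {t : ℕ}
    (h : ∀ k < t, e k = e' k) : linearPath A x e t = linearPath A x e' t := by
  induction t with
  | zero => rfl
  | succ t ih =>
    simp only [linearPath]
    rw [ih fun k hk => h k (hk.trans t.lt_succ_self), h t t.lt_succ_self]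

lemma measurable_linearPath {Ω : Type*} [MeasurableSpace Ω] (x : StateSpace n)
    {e : Ω → ℕ → StateSpace n} (he : ∀ k, Measurable fun ω => e ω k) (t : ℕ) :
    Measurable fun ω => linearPath A x (e ω) t := by
  induction t with
  | zero => exact measurable_const
  | succ t ih =>
    have := he t
    simp only [linearPath]
    fun_prop

lemma measurable_pathMap (x : StateSpace n) (N : ℕ) : Measurable (pathMap A x N) := by
  refine measurable_pi_lambda _ fun i => measurable_linearPath x (fun k => ?_) _
  by_cases h : k < N
  · simpa [h] using measurable_pi_apply _
  · simp [h]

/-- Summing `D (t + 1) ≤ ‖A‖ D t + ‖e t - e' t‖` over time. -/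
lemma one_sub_norm_mul_sum_dist_linearPath_le (x : StateSpace n)
    (e e' : ℕ → StateSpace n) (N : ℕ) :
    (1 - ‖matrixCLM A‖) * ∑ t ∈ Finset.range N,
        dist (linearPath A x e (t + 1)) (linearPath A x e' (t + 1))
      ≤ ∑ t ∈ Finset.range N, dist (e t) (e' t) := by
  set D : ℕ → ℝ := fun t => dist (linearPath A x e t) (linearPath A x e' t) with hD
  have hstep : ∀ t, D (t + 1) ≤ ‖matrixCLM A‖ * D t + dist (e t) (e' t) := fun t => by
    simp only [hD, linearPath]
    refine (dist_add_add_le _ _ _ _).trans (add_le_add_left ?_ _)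
    rw [dist_eq_norm, dist_eq_norm, ← map_sub]
    exact (matrixCLM A).le_opNorm _
  have h1 : ∑ t ∈ Finset.range N, D (t + 1)
      ≤ ‖matrixCLM A‖ * ∑ t ∈ Finset.range N, D t + ∑ t ∈ Finset.range N, dist (e t) (e' t) := by
    rw [Finset.mul_sum, ← Finset.sum_add_distrib]
    exact Finset.sum_le_sum fun t _ => hstep t
  have h2 : ∑ t ∈ Finset.range N, D t ≤ ∑ t ∈ Finset.range N, D (t + 1) := by
    have h3 : ∑ t ∈ Finset.range N, D t + D N = ∑ t ∈ Finset.range N, D (t + 1) + D 0 := by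
      rw [← Finset.sum_range_succ, ← Finset.sum_range_succ']
    have h4 : D 0 = 0 := dist_self _
    have h5 : 0 ≤ D N := dist_nonneg
    linarith
  nlinarith [mul_le_mul_of_nonneg_left h2 (norm_nonneg (matrixCLM A))]

lemma sq_sumDist_pathMap_le (hA : ‖matrixCLM A‖ ≤ 1) (x : StateSpace n) (N : ℕ)
    (e e' : Fin N → StateSpace n) :
    (1 - ‖matrixCLM A‖) ^ 2 * sumDist dist N (pathMap A x N e) (pathMap A x N e') ^ 2
      ≤ N * ∑ i, dist (e i) (e' i) ^ 2 := by
  have h := one_sub_norm_mul_sum_dist_linearPath_le (A := A) x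
    (fun k => if h : k < N then e ⟨k, h⟩ else 0) (fun k => if h : k < N then e' ⟨k, h⟩ else 0) N
  rw [Finset.sum_range, Finset.sum_range] at h
  simp only [Fin.is_lt, dite_true, Fin.eta] at h
  have h0 : 0 ≤ (1 - ‖matrixCLM A‖) * sumDist dist N (pathMap A x N e) (pathMap A x N e') :=
    mul_nonneg (by linarith) (Finset.sum_nonneg fun _ _ => dist_nonneg)
  rw [← mul_pow]
  refine (pow_le_pow_left₀ h0 h 2).trans ?_
  simpa using sq_sum_le_card_mul_sum_sq (s := Finset.univ) (f := fun i => dist (e i) (e' i))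

section Law

variable {Ω : Type*} [MeasurableSpace Ω] {Pr : Measure Ω} [IsProbabilityMeasure Pr]
  {ε : ℕ → Ω → StateSpace n} {x : StateSpace n} {y : ℕ → Ω → StateSpace n}

omit [IsProbabilityMeasure Pr] in
lemma ae_eq_linearPath (hy_zero : ∀ᵐ ω ∂Pr, y 0 ω = x)
    (hy_succ : ∀ t, ∀ᵐ ω ∂Pr, y (t + 1) ω = matrixCLM A (y t ω) + ε t ω) :
    ∀ᵐ ω ∂Pr, ∀ t, y t ω = linearPath A x (fun k => ε k ω) t := by
  filter_upwards [hy_zero, ae_all_iff.2 hy_succ] with ω h0 hs t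
  induction t with
  | zero => exact h0
  | succ t ih => rw [hs t, ih]; rfl

lemma pathLaw_eq_map_pi (hε_law : ∀ t, HasLaw (ε t) (stdGaussian (StateSpace n)) Pr)
    (hε_indep : iIndepFun ε Pr) (hy_zero : ∀ᵐ ω ∂Pr, y 0 ω = x)
    (hy_succ : ∀ t, ∀ᵐ ω ∂Pr, y (t + 1) ω = matrixCLM A (y t ω) + ε t ω) (N : ℕ) :
    pathLaw Pr y N
      = (Measure.pi fun _ : Fin N => stdGaussian (StateSpace n)).map (pathMap A x N) := by
  have h1 := (iIndepFun_iff_map_fun_eq_pi_map (fun i : Fin N => (hε_law i).aemeasurable)).1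
    (hε_indep.precomp Fin.val_injective)
  simp only [(hε_law _).map_eq] at h1
  rw [← h1, AEMeasurable.map_map_of_aemeasurable (measurable_pathMap x N).aemeasurable
    (aemeasurable_pi_lambda _ fun i : Fin N => (hε_law i).aemeasurable), pathLaw]
  refine Measure.map_congr ?_
  filter_upwards [ae_eq_linearPath hy_zero hy_succ] with ω hω
  ext1 i
  rw [hω]
  refine linearPath_congr x fun k hk => ?_
  have : k < N := lt_of_lt_of_le hk i.2
  simp [this]

end Law

lemma sumDist_self (N : ℕ) (z : Fin N → StateSpace n) : sumDist dist N z z = 0 := by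
  simp [sumDist]

lemma abs_sum_norm_sub_le_sumDist {N : ℕ} (z w : Fin N → StateSpace n) :
    |∑ i, ‖z i‖ - ∑ i, ‖w i‖| ≤ sumDist dist N z w := by
  rw [← Finset.sum_sub_distrib]
  refine (Finset.abs_sum_le_sum_abs _ _).trans (Finset.sum_le_sum fun i _ => ?_)
  rw [dist_eq_norm]
  exact abs_norm_sub_norm_le _ _

/-- The Lipschitz constant of the path as a function of the noise, from the Euclidean norm to the
`ℓ¹` distance, is at most `√N / (1 - ‖A‖)`. -/
theorem hasSubgaussianMGF_map_pathMap (hA : ‖matrixCLM A‖ < 1) (x : StateSpace n) {N : ℕ}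
    (hN : 1 ≤ N) {C : NNReal} (hC : (C : ℝ) = N / (1 - ‖matrixCLM A‖) ^ 2)
    {g : (Fin N → StateSpace n) → ℝ} (hg : Measurable g)
    (hgl : ∀ z w, |g z - g w| ≤ sumDist dist N z w) :
    Integrable g ((Measure.pi fun _ : Fin N => stdGaussian (StateSpace n)).map (pathMap A x N)) ∧
    HasSubgaussianMGF (fun z => g z - ∫ w, g w
        ∂(Measure.pi fun _ : Fin N => stdGaussian (StateSpace n)).map (pathMap A x N)) C
      ((Measure.pi fun _ : Fin N => stdGaussian (StateSpace n)).map (pathMap A x N)) := by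
  have : IsProbabilityMeasure
      ((Measure.pi fun _ : Fin N => stdGaussian (StateSpace n)).map (pathMap A x N)) :=
    Measure.isProbabilityMeasure_map (measurable_pathMap x N).aemeasurable
  have hN0 : (0 : ℝ) < N := by exact_mod_cast hN
  have hq : 0 < 1 - ‖matrixCLM A‖ := by linarith
  have hCpos : (0 : ℝ) < C := by rw [hC]; positivity
  have hs0 : ∀ z w : Fin N → StateSpace n, 0 ≤ sumDist dist N z w := fun z w =>
    Finset.sum_nonneg fun _ _ => dist_nonneg
  have hPL : ∀ s, 0 < s → s < 1 → PrekopaLeindlerIneq s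
      (fun z w : Fin N → StateSpace n => (sumDist dist N z w) ^ 2 / C)
      ((Measure.pi fun _ : Fin N => stdGaussian (StateSpace n)).map (pathMap A x N)) := by
    intro s h0 h1
    refine ((prekopaLeindlerIneq_stdGaussian h0 h1 n).pi h0 h1 N).map h0 h1
      (measurable_pathMap x N) fun e e' => ?_
    have := sq_sumDist_pathMap_le hA.le x N e e'
    rw [hC, div_div_eq_mul_div, div_le_iff₀ hN0]
    linarith
  have hL : ∀ z w : Fin N → StateSpace n, |g w - g z|
      ≤ (NNReal.sqrt C : ℝ) * √((sumDist dist N z w) ^ 2 / C) := fun z w => by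
    rw [Real.coe_sqrt, ← Real.sqrt_mul hCpos.le, mul_div_cancel₀ _ hCpos.ne',
      Real.sqrt_sq (hs0 z w), abs_sub_comm]
    exact hgl z w
  have h := hasSubgaussianMGF_of_prekopaLeindlerIneq hPL (fun z w => by positivity) hg hL
  rwa [NNReal.sq_sqrt] at h

theorem transportEntropyOne_map_pathMap (hA : ‖matrixCLM A‖ < 1) (x : StateSpace n) {N : ℕ}
    (hN : 1 ≤ N) :
    TransportEntropyOne (sumDist dist N) (N / (1 - ‖matrixCLM A‖) ^ 2)
      ((Measure.pi fun _ : Fin N => stdGaussian (StateSpace n)).map (pathMap A x N)) := by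
  have : IsProbabilityMeasure
      ((Measure.pi fun _ : Fin N => stdGaussian (StateSpace n)).map (pathMap A x N)) :=
    Measure.isProbabilityMeasure_map (measurable_pathMap x N).aemeasurable
  have hN0 : (0 : ℝ) < N := by exact_mod_cast hN
  have hq : 0 < 1 - ‖matrixCLM A‖ := by linarith
  set C : NNReal := ⟨N / (1 - ‖matrixCLM A‖) ^ 2, by positivity⟩ with hC
  have hCpos : 0 < C := by
    rw [← NNReal.coe_pos]
    show (0 : ℝ) < N / (1 - ‖matrixCLM A‖) ^ 2
    positivity
  refine transportEntropyOne_of_hasSubgaussianMGF (C := C) (K := N) (sumDist_self N)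
    (fun z w => Finset.sum_congr rfl fun i _ => dist_comm _ _) (fun u v w => ?_) ?_
    (fun z w => ?_) (fun z w => ?_) _ hCpos
    (fun g hg hgl => hasSubgaussianMGF_map_pathMap hA x hN rfl hg hgl)
  · simp only [sumDist]
    rw [← Finset.sum_add_distrib]
    exact Finset.sum_le_sum fun i _ => dist_triangle _ _ _
  · simp only [sumDist]
    fun_prop
  · refine (pi_norm_le_iff_of_nonneg (Finset.sum_nonneg fun _ _ => dist_nonneg)).2 fun i => ?_
    rw [Pi.sub_apply, ← dist_eq_norm]
    exact Finset.single_le_sum (f := fun i => dist (z i) (w i)) (fun _ _ => dist_nonneg)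
      (Finset.mem_univ i)
  · simp only [sumDist]
    refine (Finset.sum_le_card_nsmul _ _ ‖z - w‖ fun i _ => ?_).trans (by simp)
    rw [dist_eq_norm]
    exact norm_le_pi_norm (z - w) i

/-- Concentration of the empirical mean, by the Chernoff bounds for `N • avgNorm` and its
negative. -/
theorem measureReal_abs_avgNorm_sub_le (hA : ‖matrixCLM A‖ < 1) (x : StateSpace n) {N : ℕ}
    (hN : 1 ≤ N) {ρ : Measure (Fin N → StateSpace n)}
    (hρ : ρ = (Measure.pi fun _ : Fin N => stdGaussian (StateSpace n)).map (pathMap A x N)) :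
    Integrable avgNorm ρ ∧ ∀ δ : ℝ, 0 < δ →
      ρ.real {z | |avgNorm z - ∫ w, avgNorm w ∂ρ| > δ}
        ≤ 2 * Real.exp (-(N * δ ^ 2 * (1 - ‖matrixCLM A‖) ^ 2 / 2)) := by
  have hprob : IsProbabilityMeasure ρ := by
    rw [hρ]; exact Measure.isProbabilityMeasure_map (measurable_pathMap x N).aemeasurable
  have hN0 : (0 : ℝ) < N := by exact_mod_cast hN
  have hq : 0 < 1 - ‖matrixCLM A‖ := by linarith
  set C : NNReal := ⟨N / (1 - ‖matrixCLM A‖) ^ 2, by positivity⟩ with hC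
  have hCr : (C : ℝ) = N / (1 - ‖matrixCLM A‖) ^ 2 := rfl
  obtain ⟨hi, hsub⟩ := hasSubgaussianMGF_map_pathMap hA x hN hCr
    (g := fun z => ∑ i, ‖z i‖) (by fun_prop) abs_sum_norm_sub_le_sumDist
  rw [← hρ] at hi hsub
  refine ⟨hi.const_mul _, fun δ hδ => ?_⟩
  have hexp : Real.exp (-(N * δ) ^ 2 / (2 * C))
      = Real.exp (-(N * δ ^ 2 * (1 - ‖matrixCLM A‖) ^ 2 / 2)) := by
    rw [hCr]
    congr 1
    field_simp
  have h1 := hsub.measure_ge_le (ε := N * δ) (by positivity)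
  have h2 := hsub.neg.measure_ge_le (ε := N * δ) (by positivity)
  rw [hexp] at h1 h2
  rw [two_mul]
  refine le_trans ?_ (add_le_add h1 h2)
  refine le_trans (measureReal_mono ?_) (measureReal_union_le _ _)
  intro z hz
  have hz' : δ < |avgNorm z - ∫ w, avgNorm w ∂ρ| := hz
  have e : avgNorm z - ∫ w, avgNorm w ∂ρ
      = (1 / (N : ℝ)) * (∑ i, ‖z i‖ - ∫ w, ∑ i, ‖w i‖ ∂ρ) := by
    simp only [avgNorm]
    rw [integral_const_mul]
    ring
  rw [e, abs_mul, abs_of_pos (by positivity), one_div, ← div_eq_inv_mul, lt_div_iff₀ hN0,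
    mul_comm] at hz'
  rcases lt_abs.1 hz' with h | h
  · exact Or.inl h.le
  · exact Or.inr (by simpa using h.le)

end Dynamics

/-! ### Invariant measures of the kernel -/

section Kernel

variable {n : ℕ} {A : Matrix (Fin n) (Fin n) ℝ}

lemma ldsKernel_apply (u : StateSpace n) :
    ldsKernel A u = (stdGaussian (StateSpace n)).map (fun e => matrixCLM A u + e) := rfl

instance : IsMarkovKernel (ldsKernel A) :=
  ⟨fun u => by
    rw [ldsKernel_apply]
    exact Measure.isProbabilityMeasure_map (by fun_prop)⟩

lemma bind_ldsKernel (ρ : Measure (StateSpace n)) [IsProbabilityMeasure ρ] :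
    ρ.bind (ldsKernel A)
      = (ρ.prod (stdGaussian (StateSpace n))).map (fun p => matrixCLM A p.1 + p.2) := by
  have hm : Measurable fun p : StateSpace n × StateSpace n => matrixCLM A p.1 + p.2 := by fun_prop
  ext s hs
  rw [Measure.bind_apply hs (ldsKernel A).aemeasurable, Measure.map_apply hm hs,
    Measure.prod_apply (hm hs)]
  refine lintegral_congr fun u => ?_
  rw [ldsKernel_apply, Measure.map_apply (by fun_prop) hs]
  rfl

lemma bind_ldsKernel_eq_conv (ρ : Measure (StateSpace n)) [IsProbabilityMeasure ρ] :
    ρ.bind (ldsKernel A) = (ρ.map (matrixCLM A)).conv (stdGaussian (StateSpace n)) := by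
  have h := Measure.map_prod_map ρ (stdGaussian (StateSpace n)) (f := matrixCLM A) (by fun_prop)
    measurable_id
  rw [Measure.map_id] at h
  rw [bind_ldsKernel, Measure.conv, h, Measure.map_map (by fun_prop) (by fun_prop)]
  rfl

lemma charFun_bind_ldsKernel (ρ : Measure (StateSpace n)) [IsProbabilityMeasure ρ]
    (t : StateSpace n) :
    charFun (ρ.bind (ldsKernel A)) t
      = charFun ρ ((matrixCLM A).adjoint t) * Complex.exp (-‖t‖ ^ 2 / 2) := by
  have : IsProbabilityMeasure (ρ.map (matrixCLM A)) :=
    Measure.isProbabilityMeasure_map (by fun_prop)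
  rw [bind_ldsKernel_eq_conv, charFun_conv, charFun_stdGaussian]
  congr 1
  rw [charFun_apply, charFun_apply, integral_map (by fun_prop) (by fun_prop)]
  simp [ContinuousLinearMap.adjoint_inner_right]

/-- The difference `Δ` of two invariant characteristic functions satisfies `|Δ(t)| ≤ |Δ(Aᵀ t)|`, and
`(Aᵀ)ᵏ t → 0`. -/
theorem eq_of_invariant_ldsKernel (hA : ‖matrixCLM A‖ < 1) {ν ν' : Measure (StateSpace n)}
    [IsProbabilityMeasure ν] [IsProbabilityMeasure ν'] (hν : (ldsKernel A).Invariant ν)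
    (hν' : (ldsKernel A).Invariant ν') : ν = ν' := by
  refine Measure.ext_of_charFun ?_
  ext t
  set B := (matrixCLM A).adjoint with hB
  set Δ : StateSpace n → ℂ := fun t => charFun ν t - charFun ν' t with hΔ
  have hstep : ∀ t, ‖Δ t‖ ≤ ‖Δ (B t)‖ := by
    intro t
    have e : Δ t = Δ (B t) * Complex.exp (-‖t‖ ^ 2 / 2) := by
      simp only [hΔ, sub_mul, hB]
      rw [← charFun_bind_ldsKernel, ← charFun_bind_ldsKernel, hν.def, hν'.def]
    rw [e, norm_mul]
    refine mul_le_of_le_one_right (norm_nonneg _) ?_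
    rw [Complex.norm_exp]
    refine Real.exp_le_one_iff.2 ?_
    have : (-(‖t‖ : ℂ) ^ 2 / 2) = ((-‖t‖ ^ 2 / 2 : ℝ) : ℂ) := by push_cast; ring
    rw [this, Complex.ofReal_re]
    have := sq_nonneg ‖t‖
    linarith
  have hiter : ∀ k : ℕ, ‖Δ t‖ ≤ ‖Δ ((B ^ k) t)‖ := by
    intro k
    induction k with
    | zero => simp
    | succ k ih =>
      rw [pow_succ']
      exact ih.trans (hstep _)
  have hB1 : ‖B‖ < 1 := by rwa [hB, LinearIsometryEquiv.norm_map]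
  have hlim : Filter.Tendsto (fun k : ℕ => (B ^ k) t) Filter.atTop (nhds 0) := by
    have h1 := tendsto_pow_atTop_nhds_zero_of_norm_lt_one hB1
    have h2 := ((ContinuousLinearMap.apply ℝ (StateSpace n) t).continuous.tendsto 0).comp h1
    rw [map_zero] at h2
    exact h2
  have hΔc : Continuous Δ := continuous_charFun.sub continuous_charFun
  have h3 := ((hΔc.norm.tendsto 0).comp hlim)
  have h4 : ‖Δ t‖ ≤ ‖Δ 0‖ := ge_of_tendsto h3 (Filter.Eventually.of_forall hiter)
  have h5 : Δ 0 = 0 := by simp [hΔ]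
  rw [h5, norm_zero] at h4
  exact sub_eq_zero.1 (norm_le_zero_iff.1 h4)

/-- The centered Gaussian measure with covariance `∑ Aᵏ (Aᵏ)ᵀ` is invariant. -/
theorem exists_invariant_ldsKernel (hA : ‖matrixCLM A‖ < 1) :
    ∃ ν : Measure (StateSpace n), IsGaussian ν ∧ (ldsKernel A).Invariant ν := by
  set M := matrixCLM A with hM
  have hterm : ∀ k : ℕ, ‖M ^ k * (star M) ^ k‖ ≤ (‖M‖ ^ 2) ^ k := fun k => by
    refine (norm_mul_le _ _).trans ?_
    have h1 : ‖M ^ k‖ ≤ ‖M‖ ^ k := by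
      rcases k with - | k
      · rw [pow_zero, pow_zero]
        exact ContinuousLinearMap.norm_id_le
      · exact norm_pow_le' _ k.succ_pos
    have h2 : ‖(star M) ^ k‖ ≤ ‖M‖ ^ k := by
      rwa [← star_pow, ContinuousLinearMap.star_eq_adjoint, LinearIsometryEquiv.norm_map]
    calc _ ≤ ‖M‖ ^ k * ‖M‖ ^ k := mul_le_mul h1 h2 (norm_nonneg _) (by positivity)
      _ = (‖M‖ ^ 2) ^ k := by ring
  have hsum : Summable fun k : ℕ => M ^ k * (star M) ^ k :=
    Summable.of_norm_bounded (summable_geometric_of_lt_one (by positivity)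
      (pow_lt_one₀ (norm_nonneg _) hA two_ne_zero)) hterm
  set V := ∑' k : ℕ, M ^ k * (star M) ^ k with hV
  have hVrec : V = 1 + M * V * star M := by
    have e : ∀ k : ℕ, M ^ (k + 1) * (star M) ^ (k + 1) = M * (M ^ k * (star M) ^ k) * star M :=
      fun k => by rw [pow_succ', pow_succ]; simp only [mul_assoc]
    conv_lhs => rw [hV, hsum.tsum_eq_zero_add]
    simp only [e, pow_zero, mul_one]
    rw [(hsum.mul_left M).tsum_mul_right, hsum.tsum_mul_left]
  have hVstar : star V = V := by
    rw [hV]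
    refine (tsum_star (f := fun k : ℕ => M ^ k * (star M) ^ k)).trans ?_
    refine tsum_congr fun k => ?_
    rw [star_mul, star_pow, star_pow, star_star]
  have hVpos : ∀ t, 0 ≤ inner ℝ t (V t) := by
    intro t
    have h1 := ((innerSL ℝ t).comp (ContinuousLinearMap.apply ℝ (StateSpace n) t)).hasSum
      hsum.hasSum
    refine HasSum.nonneg (fun k => ?_) h1
    have h2 : inner ℝ t ((M ^ k * (star M) ^ k) t)
        = inner ℝ ((star M ^ k) t) ((star M ^ k) t) := by
      rw [mul_apply_eq_comp, ← ContinuousLinearMap.adjoint_inner_left,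
        ← ContinuousLinearMap.star_eq_adjoint, star_pow]
    exact real_inner_self_nonneg.trans_eq h2.symm
  set S : Matrix (Fin n) (Fin n) ℝ := (Matrix.toEuclideanCLM (n := Fin n) (𝕜 := ℝ)).symm V with hS
  have hSV : Matrix.toEuclideanCLM (n := Fin n) (𝕜 := ℝ) S = V := by simp [hS]
  have hquad : ∀ t : StateSpace n, t.ofLp ⬝ᵥ S.mulVec t.ofLp = inner ℝ t (V t) := fun t => by
    rw [← hSV, Matrix.inner_toEuclideanCLM]
  have hSpos : S.PosSemidef := by
    refine Matrix.PosSemidef.of_dotProduct_mulVec_nonneg ?_ fun t => ?_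
    · show star S = S
      refine (Matrix.toEuclideanCLM (n := Fin n) (𝕜 := ℝ)).injective ?_
      have h1 : Matrix.toEuclideanCLM (n := Fin n) (𝕜 := ℝ) (star S) =
          star (Matrix.toEuclideanCLM (n := Fin n) (𝕜 := ℝ) S) :=
        (Matrix.toEuclideanCLM (n := Fin n) (𝕜 := ℝ)).map_star' S
      exact (h1.trans (by rw [hSV, hVstar])).trans hSV.symm
    · have := hVpos (WithLp.toLp 2 t)
      rw [← hquad] at this
      simpa using this
  refine ⟨multivariateGaussian 0 S, inferInstance, ?_⟩
  refine Measure.ext_of_charFun ?_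
  ext t
  rw [charFun_bind_ldsKernel, charFun_multivariateGaussian hSpos,
    charFun_multivariateGaussian hSpos, ← Complex.exp_add]
  have hq : inner ℝ t (V t) = ‖t‖ ^ 2 + inner ℝ (M.adjoint t) (V (M.adjoint t)) := by
    conv_lhs => rw [hVrec]
    rw [add_apply, inner_add_right, ContinuousLinearMap.adjoint_inner_left]
    simp [ContinuousLinearMap.star_eq_adjoint]
  congr 1
  simp only [hquad, hq, inner_zero_right]
  push_cast
  ring

end Kernel

/-! ### Contraction and the bias of the empirical mean -/

section Contraction

variable {n : ℕ} {A : Matrix (Fin n) (Fin n) ℝ}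

lemma LipschitzWith.integrable_of_integrable_norm {E : Type*} [NormedAddCommGroup E]
    [MeasurableSpace E] [BorelSpace E] {ρ : Measure E} [IsFiniteMeasure ρ] {K : NNReal} {g : E → ℝ}
    (hg : LipschitzWith K g) (hρ : Integrable (fun v => ‖v‖) ρ) : Integrable g ρ := by
  refine ((hρ.const_mul K).add (integrable_const ‖g 0‖)).mono'
    hg.continuous.aestronglyMeasurable (Filter.Eventually.of_forall fun v => ?_)
  have h1 := hg.norm_sub_le v 0
  have h2 := norm_sub_norm_le (g v) (g 0)
  rw [sub_zero] at h1
  simp only [Pi.add_apply]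
  linarith

/-- The easy half of Kantorovich–Rubinstein duality. -/
lemma abs_integral_sub_integral_le_wassersteinDist {E : Type*} [NormedAddCommGroup E]
    [MeasurableSpace E] [BorelSpace E] [SecondCountableTopology E] {μ ν : Measure E}
    [IsProbabilityMeasure μ] [IsProbabilityMeasure ν] {K : NNReal} {g : E → ℝ}
    (hg : LipschitzWith K g) (hμ : Integrable g μ) (hν : Integrable g ν)
    (hW : wassersteinDist dist μ ν ≠ ∞) :
    |∫ v, g v ∂μ - ∫ v, g v ∂ν| ≤ K * (wassersteinDist dist μ ν).toReal := by
  have key : ∀ π : Measure (E × E), π.fst = μ ∧ π.snd = ν →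
      ENNReal.ofReal |∫ v, g v ∂μ - ∫ v, g v ∂ν|
        ≤ K * ∫⁻ z, ENNReal.ofReal (dist z.1 z.2) ∂π := by
    rintro π ⟨rfl, rfl⟩
    have h1 : Integrable (fun z => g z.1) π := hμ.comp_measurable measurable_fst
    have h2 : Integrable (fun z => g z.2) π := hν.comp_measurable measurable_snd
    rw [Measure.fst, Measure.snd, integral_map (by fun_prop) hg.continuous.aestronglyMeasurable,
      integral_map (by fun_prop) hg.continuous.aestronglyMeasurable,
      ← integral_sub h1 h2,
      ← lintegral_const_mul' _ _ ENNReal.coe_ne_top, ← Real.norm_eq_abs, ofReal_norm]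
    refine (enorm_integral_le_lintegral_enorm _).trans (lintegral_mono fun z => ?_)
    rw [← ofReal_norm, ← dist_eq_norm, ← edist_dist, ← edist_dist]
    exact hg z.1 z.2
  -- the case `K = 0` is separate because `0 * ⊤ = 0` prevents moving `K` into the infimum
  rcases eq_or_ne K 0 with rfl | hK
  · obtain ⟨π, hπ⟩ : ∃ π : Measure (E × E), π.fst = μ ∧ π.snd = ν := ⟨μ.prod ν, by simp, by simp⟩
    simpa using key π hπ
  have h : ENNReal.ofReal |∫ v, g v ∂μ - ∫ v, g v ∂ν| ≤ K * wassersteinDist dist μ ν := by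
    rw [mul_comm, ← ENNReal.div_le_iff (by simpa using hK) ENNReal.coe_ne_top]
    refine le_iInf₂ fun π hπ => ?_
    rw [ENNReal.div_le_iff (by simpa using hK) ENNReal.coe_ne_top, mul_comm]
    exact key π hπ
  have h2 := ENNReal.toReal_mono (ENNReal.mul_ne_top ENNReal.coe_ne_top hW) h
  rwa [ENNReal.toReal_ofReal (abs_nonneg _), ENNReal.toReal_mul, ENNReal.coe_toReal] at h2

lemma wassersteinDist_dist_ne_top {E : Type*} [NormedAddCommGroup E]
    [MeasurableSpace E] [BorelSpace E] [SecondCountableTopology E] {μ ν : Measure E}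
    [IsProbabilityMeasure μ] [IsProbabilityMeasure ν] (hμ : Integrable (fun v => ‖v‖) μ)
    (hν : Integrable (fun v => ‖v‖) ν) : wassersteinDist dist μ ν ≠ ∞ := by
  have hi : Integrable (fun z : E × E => ‖z.1‖ + ‖z.2‖) (μ.prod ν) :=
    (hμ.comp_fst ν).add (hν.comp_snd μ)
  refine ne_top_of_le_ne_top hi.lintegral_lt_top.ne
    ((iInf₂_le (μ.prod ν) ⟨by simp, by simp⟩).trans (lintegral_mono fun z => ?_))
  exact ENNReal.ofReal_le_ofReal (dist_eq_norm z.1 z.2 ▸ norm_sub_le _ _)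

lemma integrable_norm_stdGaussian : Integrable (fun v => ‖v‖) (stdGaussian (StateSpace n)) :=
  (IsGaussian.integrable_id (μ := stdGaussian (StateSpace n))).norm

/-- The transition operator of the kernel, acting on functions. -/
noncomputable def ldsOperator (A : Matrix (Fin n) (Fin n) ℝ) (g : StateSpace n → ℝ)
    (u : StateSpace n) : ℝ :=
  ∫ e, g (matrixCLM A u + e) ∂stdGaussian (StateSpace n)

lemma LipschitzWith.ldsOperator {K : NNReal} {g : StateSpace n → ℝ} (hg : LipschitzWith K g) :
    LipschitzWith (‖matrixCLM A‖₊ * K) (ldsOperator A g) := by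
  have hi : ∀ u, Integrable (fun e => g (matrixCLM A u + e)) (stdGaussian (StateSpace n)) :=
    fun u => LipschitzWith.integrable_of_integrable_norm (K := K)
      (by
        have h := hg.comp (isometry_add_left (matrixCLM A u)).lipschitz
        rw [mul_one] at h
        exact h)
      integrable_norm_stdGaussian
  refine LipschitzWith.of_dist_le_mul fun u v => ?_
  rw [Real.dist_eq, ← Real.norm_eq_abs, _root_.ldsOperator, _root_.ldsOperator,
    ← integral_sub (hi u) (hi v)]
  refine (norm_integral_le_of_norm_le_const (C := K * (‖matrixCLM A‖ * dist u v))
    (Filter.Eventually.of_forall fun e => ?_)).trans (le_of_eq ?_)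
  · refine (hg.norm_sub_le _ _).trans ?_
    rw [add_sub_add_right_eq_sub, ← map_sub, dist_eq_norm]
    gcongr
    exact (matrixCLM A).le_opNorm _
  · simp; ring

lemma integral_bind_ldsKernel {ρ : Measure (StateSpace n)} [IsProbabilityMeasure ρ]
    (hρ : Integrable (fun v => ‖v‖) (ρ.bind (ldsKernel A))) {K : NNReal} {g : StateSpace n → ℝ}
    (hg : LipschitzWith K g) :
    ∫ v, g v ∂ρ.bind (ldsKernel A) = ∫ u, ldsOperator A g u ∂ρ := by
  have hi := hg.integrable_of_integrable_norm hρ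
  rw [bind_ldsKernel] at hi ⊢
  have hm : Measurable fun p : StateSpace n × StateSpace n => matrixCLM A p.1 + p.2 := by fun_prop
  rw [integral_map hm.aemeasurable hi.1]
  exact integral_prod _ (hi.comp_measurable hm)

lemma LipschitzWith.iterate_ldsOperator {K : NNReal} {g : StateSpace n → ℝ}
    (hg : LipschitzWith K g) (k : ℕ) :
    LipschitzWith (‖matrixCLM A‖₊ ^ k * K) ((_root_.ldsOperator A)^[k] g) := by
  induction k with
  | zero => simpa using hg
  | succ k ih =>
    rw [Function.iterate_succ_apply', pow_succ', mul_assoc]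
    exact ih.ldsOperator

/-- Along a sequence of laws evolving under the kernel, time can be moved from the law to the
function. -/
lemma integral_eq_integral_iterate_ldsOperator {m : ℕ → Measure (StateSpace n)}
    [∀ t, IsProbabilityMeasure (m t)] (hm : ∀ t, m (t + 1) = (m t).bind (ldsKernel A))
    (hint : ∀ t, Integrable (fun v => ‖v‖) (m t)) {K : NNReal} {g : StateSpace n → ℝ}
    (hg : LipschitzWith K g) (k : ℕ) :
    ∫ v, g v ∂m k = ∫ v, (ldsOperator A)^[k] g v ∂m 0 := by
  induction k generalizing K g with
  | zero => rfl
  | succ k ih =>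
    have h := hint (k + 1)
    rw [hm k] at h ⊢
    rw [integral_bind_ldsKernel h hg, ih hg.ldsOperator, Function.iterate_succ_apply]

/-- Contraction towards equilibrium: the `k`-step transition operator multiplies Lipschitz constants
by `‖A‖ᵏ`. -/
theorem abs_integral_norm_sub_le {m : ℕ → Measure (StateSpace n)}
    [∀ t, IsProbabilityMeasure (m t)] (hm : ∀ t, m (t + 1) = (m t).bind (ldsKernel A))
    (hint : ∀ t, Integrable (fun v => ‖v‖) (m t)) {ν : Measure (StateSpace n)}
    [IsProbabilityMeasure ν] (hν : (ldsKernel A).Invariant ν) (hνi : Integrable (fun v => ‖v‖) ν)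
    (k : ℕ) :
    |∫ v, ‖v‖ ∂m k - ∫ v, ‖v‖ ∂ν|
      ≤ ‖matrixCLM A‖ ^ k * (wassersteinDist dist (m 0) ν).toReal := by
  have hg : LipschitzWith 1 (fun v : StateSpace n => ‖v‖) := lipschitzWith_one_norm
  rw [integral_eq_integral_iterate_ldsOperator hm hint hg k,
    integral_eq_integral_iterate_ldsOperator (m := fun _ => ν) (A := A) (fun _ => hν.def.symm)
      (fun _ => hνi) hg k]
  have hk := hg.iterate_ldsOperator (A := A) k
  have h := abs_integral_sub_integral_le_wassersteinDist hk
    (hk.integrable_of_integrable_norm (hint 0)) (hk.integrable_of_integrable_norm hνi)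
    (wassersteinDist_dist_ne_top (hint 0) hνi)
  simpa using h

/-- By uniqueness, the invariant measure is Gaussian and therefore has a first moment. -/
lemma integrable_norm_of_invariant (hA : ‖matrixCLM A‖ < 1) {ν : Measure (StateSpace n)}
    [IsProbabilityMeasure ν] (hν : (ldsKernel A).Invariant ν) : Integrable (fun v => ‖v‖) ν := by
  obtain ⟨ν', hν'g, hν'⟩ := exists_invariant_ldsKernel hA
  rw [eq_of_invariant_ldsKernel hA hν hν']
  exact (IsGaussian.integrable_id (μ := ν')).norm

section Law

variable {Ω : Type*} [MeasurableSpace Ω] {Pr : Measure Ω} [IsProbabilityMeasure Pr]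
  {ε : ℕ → Ω → StateSpace n} {x : StateSpace n} {y : ℕ → Ω → StateSpace n}

omit [IsProbabilityMeasure Pr] in
lemma aemeasurable_of_recursion (hε_law : ∀ t, HasLaw (ε t) (stdGaussian (StateSpace n)) Pr)
    (hy_zero : ∀ᵐ ω ∂Pr, y 0 ω = x)
    (hy_succ : ∀ t, ∀ᵐ ω ∂Pr, y (t + 1) ω = matrixCLM A (y t ω) + ε t ω) (t : ℕ) :
    AEMeasurable (y t) Pr := by
  induction t with
  | zero => exact aemeasurable_const.congr (Filter.EventuallyEq.symm hy_zero)
  | succ t ih =>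
    have := (hε_law t).aemeasurable
    exact AEMeasurable.congr (f := fun ω => matrixCLM A (y t ω) + ε t ω) (by fun_prop)
      (Filter.EventuallyEq.symm (hy_succ t))

lemma integrable_of_recursion (hε_law : ∀ t, HasLaw (ε t) (stdGaussian (StateSpace n)) Pr)
    (hy_zero : ∀ᵐ ω ∂Pr, y 0 ω = x)
    (hy_succ : ∀ t, ∀ᵐ ω ∂Pr, y (t + 1) ω = matrixCLM A (y t ω) + ε t ω) (t : ℕ) :
    Integrable (y t) Pr := by
  induction t with
  | zero => exact (integrable_const x).congr (Filter.EventuallyEq.symm hy_zero)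
  | succ t ih =>
    have h1 : Integrable (ε t) Pr := by
      have h2 : Integrable id (Pr.map (ε t)) := by
        rw [(hε_law t).map_eq]; exact IsGaussian.integrable_id
      exact h2.comp_aemeasurable (hε_law t).aemeasurable
    exact (((matrixCLM A).integrable_comp ih).add h1).congr (Filter.EventuallyEq.symm (hy_succ t))

/-- The current state is a function of the past noise, hence independent of the present noise. -/
lemma map_succ_eq_bind_ldsKernel (hε_law : ∀ t, HasLaw (ε t) (stdGaussian (StateSpace n)) Pr)
    (hε_indep : iIndepFun ε Pr) (hy_zero : ∀ᵐ ω ∂Pr, y 0 ω = x)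
    (hy_succ : ∀ t, ∀ᵐ ω ∂Pr, y (t + 1) ω = matrixCLM A (y t ω) + ε t ω) (t : ℕ) :
    Pr.map (y (t + 1)) = (Pr.map (y t)).bind (ldsKernel A) := by
  have hym := aemeasurable_of_recursion hε_law hy_zero hy_succ t
  have hprob : IsProbabilityMeasure (Pr.map (y t)) := Measure.isProbabilityMeasure_map hym
  have hind : IndepFun (y t) (ε t) Pr := by
    have h1 := iIndepFun.indepFun_finset₀ (Finset.range t) {t} (by simp) hε_indep
      fun i => (hε_law i).aemeasurable
    have hφ : Measurable fun z : Finset.range t → StateSpace n =>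
        linearPath A x (fun k => if h : k ∈ Finset.range t then z ⟨k, h⟩ else 0) t := by
      refine measurable_linearPath x (fun k => ?_) t
      by_cases h : k ∈ Finset.range t
      · simp only [h, dite_true]; exact measurable_pi_apply _
      · simp only [h, dite_false]; exact measurable_const
    have hψ : Measurable fun z : ({t} : Finset ℕ) → StateSpace n =>
        z ⟨t, Finset.mem_singleton_self t⟩ := measurable_pi_apply _
    refine (h1.comp hφ hψ).congr ?_ (Filter.EventuallyEq.rfl)
    filter_upwards [ae_eq_linearPath hy_zero hy_succ] with ω hω
    rw [hω]
    refine linearPath_congr x fun k hk => ?_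
    simp [hk]
  have h2 := (indepFun_iff_map_prod_eq_prod_map_map hym (hε_law t).aemeasurable).1 hind
  rw [(hε_law t).map_eq] at h2
  have hm : Measurable fun p : StateSpace n × StateSpace n => matrixCLM A p.1 + p.2 := by fun_prop
  rw [bind_ldsKernel, ← h2, AEMeasurable.map_map_of_aemeasurable hm.aemeasurable
    (hym.prodMk (hε_law t).aemeasurable)]
  exact Measure.map_congr (hy_succ t)

omit [IsProbabilityMeasure Pr] in
lemma map_one_eq_ldsKernel (hε_law : ∀ t, HasLaw (ε t) (stdGaussian (StateSpace n)) Pr)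
    (hy_zero : ∀ᵐ ω ∂Pr, y 0 ω = x)
    (hy_succ : ∀ t, ∀ᵐ ω ∂Pr, y (t + 1) ω = matrixCLM A (y t ω) + ε t ω) :
    Pr.map (y 1) = ldsKernel A x := by
  rw [ldsKernel_apply, ← (hε_law 0).map_eq, AEMeasurable.map_map_of_aemeasurable
    (by fun_prop) (hε_law 0).aemeasurable]
  refine Measure.map_congr ?_
  filter_upwards [hy_zero, hy_succ 0] with ω h0 h1
  rw [zero_add] at h1
  rw [h1, h0]; rfl

/-- The bias of the empirical mean: the `i`-th term contributes at most `‖A‖^i W / N`. -/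
theorem abs_integral_avgNorm_sub_le (hA : ‖matrixCLM A‖ < 1)
    (hε_law : ∀ t, HasLaw (ε t) (stdGaussian (StateSpace n)) Pr)
    (hε_indep : iIndepFun ε Pr) (hy_zero : ∀ᵐ ω ∂Pr, y 0 ω = x)
    (hy_succ : ∀ t, ∀ᵐ ω ∂Pr, y (t + 1) ω = matrixCLM A (y t ω) + ε t ω)
    {ν : Measure (StateSpace n)} [IsProbabilityMeasure ν] (hν : (ldsKernel A).Invariant ν)
    (hνi : Integrable (fun v => ‖v‖) ν) {N : ℕ} (hN : 1 ≤ N) :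
    |∫ z, avgNorm z ∂(pathLaw Pr y N) - ∫ v, ‖v‖ ∂ν|
      ≤ (wassersteinDist dist (ldsKernel A x) ν).toReal / (N * (1 - ‖matrixCLM A‖)) := by
  have hN0 : (0 : ℝ) < N := by exact_mod_cast hN
  have hq : 0 < 1 - ‖matrixCLM A‖ := by linarith
  have hym := aemeasurable_of_recursion hε_law hy_zero hy_succ
  have hyi := integrable_of_recursion hε_law hy_zero hy_succ
  have hprob : ∀ t, IsProbabilityMeasure (Pr.map (y (t + 1))) := fun t =>
    Measure.isProbabilityMeasure_map (hym _)
  have hterm := abs_integral_norm_sub_le (m := fun t => Pr.map (y (t + 1)))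
    (fun t => map_succ_eq_bind_ldsKernel hε_law hε_indep hy_zero hy_succ (t + 1))
    (fun t => (integrable_map_measure (by fun_prop) (hym _)).2 (hyi _).norm) hν hνi
  simp only [zero_add, map_one_eq_ldsKernel hε_law hy_zero hy_succ] at hterm
  set W := (wassersteinDist dist (ldsKernel A x) ν).toReal with hW
  have hW0 : 0 ≤ W := ENNReal.toReal_nonneg
  have e1 : ∫ z, avgNorm z ∂(pathLaw Pr y N)
      = (1 / (N : ℝ)) * ∑ i : Fin N, ∫ v, ‖v‖ ∂(Pr.map (y (i + 1))) := by
    have hm : AEMeasurable (fun ω (i : Fin N) => y (i + 1) ω) Pr :=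
      aemeasurable_pi_lambda _ fun i => hym _
    have ha : Measurable (avgNorm (n := n) (N := N)) := by unfold avgNorm; fun_prop
    rw [pathLaw, integral_map hm ha.aestronglyMeasurable]
    simp only [avgNorm]
    rw [integral_const_mul, integral_finsetSum _ fun i _ => (hyi _).norm]
    congr 1
    refine Finset.sum_congr rfl fun i _ => ?_
    rw [integral_map (hym _) (by fun_prop)]
  have e2 : ∫ v, ‖v‖ ∂ν = (1 / (N : ℝ)) * ∑ _i : Fin N, ∫ v, ‖v‖ ∂ν := by
    simp only [Finset.sum_const, Finset.card_univ, Fintype.card_fin, nsmul_eq_mul]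
    field_simp
  rw [e1, e2, ← mul_sub, ← Finset.sum_sub_distrib, abs_mul, abs_of_pos (by positivity)]
  have hgeom : ∑ i : Fin N, ‖matrixCLM A‖ ^ (i : ℕ) ≤ (1 - ‖matrixCLM A‖)⁻¹ := by
    rw [← Finset.sum_range (fun i => ‖matrixCLM A‖ ^ i),
      ← tsum_geometric_of_lt_one (norm_nonneg _) hA]
    exact (summable_geometric_of_lt_one (norm_nonneg _) hA).sum_le_tsum _
      fun i _ => by positivity
  calc _ ≤ 1 / (N : ℝ) * ∑ i : Fin N, ‖matrixCLM A‖ ^ (i : ℕ) * W := by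
        gcongr
        exact (Finset.abs_sum_le_sum_abs _ _).trans (Finset.sum_le_sum fun i _ => hterm i)
    _ ≤ 1 / (N : ℝ) * ((1 - ‖matrixCLM A‖)⁻¹ * W) := by
        rw [← Finset.sum_mul]
        gcongr
    _ = W / (N * (1 - ‖matrixCLM A‖)) := by field_simp

end Law

end Contraction

/-! ### The transport inequality, ergodicity and concentration -/

theorem mainTheorem5
    {n : ℕ} (A : Matrix (Fin n) (Fin n) ℝ) (lam : ℝ)
    (hA : ‖matrixCLM A‖ = lam) (hlam : lam < 1)
    {Ω : Type*} [MeasurableSpace Ω] (Pr : Measure Ω) [IsProbabilityMeasure Pr]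
    (ε : ℕ → Ω → StateSpace n)
    (hε_law : ∀ t, HasLaw (ε t) (stdGaussian (StateSpace n)) Pr)
    (hε_indep : iIndepFun ε Pr)
    (x : StateSpace n) (y : ℕ → Ω → StateSpace n)
    (hy_zero : ∀ᵐ ω ∂Pr, y 0 ω = x)
    (hy_succ : ∀ t, ∀ᵐ ω ∂Pr, y (t + 1) ω = matrixCLM A (y t ω) + ε t ω) :
    -- the path law satisfies the transport-entropy inequality
    (∀ N : ℕ, 1 ≤ N →
      TransportEntropyOne (sumDist dist N) (N / (1 - lam) ^ 2) (pathLaw Pr y N)) ∧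
    -- there is exactly one invariant probability measure
    (∃! ν : Measure (StateSpace n), IsProbabilityMeasure ν ∧ (ldsKernel A).Invariant ν) ∧
    -- deviation of the empirical average from its stationary mean
    (∀ ν : Measure (StateSpace n), IsProbabilityMeasure ν → (ldsKernel A).Invariant ν →
      Integrable (fun v => ‖v‖) ν ∧
      wassersteinDist dist (ldsKernel A x) ν ≠ ∞ ∧
      ∀ N : ℕ, 1 ≤ N →
        Integrable avgNorm (pathLaw Pr y N) ∧
        ∀ δ : ℝ, 0 < δ →
          (pathLaw Pr y N).real {z | |avgNorm z - ∫ v, ‖v‖ ∂ν| >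
              (wassersteinDist dist (ldsKernel A x) ν).toReal / (N * (1 - lam)) + δ}
            ≤ (pathLaw Pr y N).real {z | |avgNorm z - ∫ w, avgNorm w ∂(pathLaw Pr y N)| > δ} ∧
          (pathLaw Pr y N).real {z | |avgNorm z - ∫ w, avgNorm w ∂(pathLaw Pr y N)| > δ}
            ≤ 2 * Real.exp (-(N * δ ^ 2 * (1 - lam) ^ 2 / 2))) := by
  subst hA
  have hlaw := pathLaw_eq_map_pi hε_law hε_indep hy_zero hy_succ
  refine ⟨fun N hN => ?_, ?_, fun ν hνp hν => ?_⟩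
  · rw [hlaw]
    exact transportEntropyOne_map_pathMap hlam x hN
  · obtain ⟨ν, hνp, hν⟩ := exists_invariant_ldsKernel hlam
    exact ⟨ν, ⟨inferInstance, hν⟩, fun ν' ⟨_, hν'⟩ => eq_of_invariant_ldsKernel hlam hν' hν⟩
  · have hνi := integrable_norm_of_invariant hlam hν
    have hPi : Integrable (fun v => ‖v‖) (ldsKernel A x) := by
      rw [← map_one_eq_ldsKernel hε_law hy_zero hy_succ]
      exact (integrable_map_measure (by fun_prop)
        (aemeasurable_of_recursion hε_law hy_zero hy_succ 1)).2
        (integrable_of_recursion hε_law hy_zero hy_succ 1).norm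
    refine ⟨hνi, wassersteinDist_dist_ne_top hPi hνi, fun N hN => ?_⟩
    obtain ⟨hint, hconc⟩ := measureReal_abs_avgNorm_sub_le hlam x hN (hlaw N)
    refine ⟨hint, fun δ hδ => ⟨?_, hconc δ hδ⟩⟩
    have hprob : IsProbabilityMeasure (pathLaw Pr y N) := by
      rw [hlaw]
      exact Measure.isProbabilityMeasure_map (measurable_pathMap x N).aemeasurable
    have hbias := abs_integral_avgNorm_sub_le hlam hε_law hε_indep hy_zero hy_succ hν hνi hN
    refine measureReal_mono fun z hz => ?_
    have h1 := abs_sub_le (avgNorm z) (∫ w, avgNorm w ∂(pathLaw Pr y N)) (∫ v, ‖v‖ ∂ν)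
    simp only [Set.mem_ofPred_eq] at hz ⊢
    linarith
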